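/- Conventions. A matroid $\mathsf{M}$ has a finite ground set $E$; its base polytope is $\mathscr{P}(\mathsf{M})=\operatorname{conv}\{e_B : B \text{ a basis of } \mathsf{M}\}\subseteq\mathbb{R}^E$. For $X\subseteq\mathbb{R}^E$ let $\mathbb{1}_X:\mathbb{R}^E\to\mathbb{Z}$ be its indicator function, and let $\mathscr{P}^\circ$ be the relative interior of $\mathscr{P}$. A map $f$ from the matroids on $E$ to an abelian group $A$ is a *valuation* (respectively a *covaluation*) if there is a homomorphism $\widehat f$ to $A$ from the group of integer combinations of the functions $\mathbb{1}_{\mathscr{P}(\mathsf{M})}$ (respectively $\mathbb{1}_{\mathscr{P}(\mathsf{M})^\circ}$), $\mathsf{M}$ a matroid on $E$, such that $f(\mathsf{M})=\widehat f(\mathbb{1}_{\mathscr{P}(\mathsf{M})})$ (respectively $f(\mathsf{M})=\widehat f(\mathbb{1}_{\mathscr{P}(\mathsf{M})^\circ})$) for all $\mathsf{M}$. Two elements $e\ne f$ are parallel if $\{e,f\}$ is a circuit. A parallel extension of $\mathsf{M}$ is a matroid obtained by adding one new element parallel to an element of $\mathsf{M}$; a series extension of $\mathsf{M}$ is the dual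 of a parallel extension of $\mathsf{M}^*$. A matroid is *series-parallel* if it is obtained from a copy of $\mathsf{U}_{1,1}$ by finitely many parallel and series extensions. Theorem. Let $E$ be a finite set. 1. For every matroid $\mathsf{M}$ on $E$, $\mathbb{1}_{\mathscr{P}(\mathsf{M})}$ is an integer combination of functions $\mathbb{1}_{\mathscr{P}(\mathsf{N})}$, where each $\mathsf{N}$ is a matroid on $E$ that is a (possibly empty) direct sum of series-parallel matroids and copies of $\mathsf{U}_{0,1}$. 2. Consequently, two valuations from the matroids on $E$ to an abelian group $A$ that agree on all direct sums of series-parallel matroids and copies of $\mathsf{U}_{0,1}$ are equal. 3. There is at most one map $g$ from the matroids whose ground sets are finite sets of positive integers to $\mathbb{Z}[t]$ such that: $g$ takes equal values on isomorphic matroids; for every finite set $E$ of positive integers the restriction of $g$ to matroids on $E$ is a covaluation; $g(\mathsf{M})=0$ if $\mathsf{M}$ has a loop; and $g(\mathsf{M})=t^m$ if $\mathsf{M}$ is a direct sum of $m\ge 0$ connected series-parallel matroids. (That is, Speyer's $g$-invariant is unique.) -/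

import Mathlib

namespace MatroidSpan

universe u v

/-- Matroids with ground set exactly `E`. -/
abbrev MatroidOn {α : Type u} (E : Set α) : Type u := {M : Matroid α // M.E = E}

/-! ### Base polytopes and indicator functions -/

/-- The base polytope of a matroid on `E`: the convex hull in `ℝ^E` of the vectors `e_B`,
where `B` ranges over the bases. -/
noncomputable def basePolytope {α : Type u} {E : Set α} (M : MatroidOn E) : Set (E → ℝ) :=
  convexHull ℝ {x | ∃ B, M.1.IsBase B ∧ x = fun i : E => B.indicator (fun _ => (1 : ℝ)) (i : α)}

/-- The integer-valued indicator function of the base polytope. -/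
noncomputable def polytopeIndicator {α : Type u} {E : Set α} (M : MatroidOn E) : (E → ℝ) → ℤ :=
  (basePolytope M).indicator (fun _ => 1)

/-- The integer-valued indicator function of the relative interior of the base polytope. -/
noncomputable def interiorIndicator {α : Type u} {E : Set α} (M : MatroidOn E) : (E → ℝ) → ℤ :=
  (intrinsicInterior ℝ (basePolytope M)).indicator (fun _ => 1)

/-- The group of all integer combinations of indicator functions of base polytopes of
matroids on `E`. -/
def indicatorGroup {α : Type u} (E : Set α) : AddSubgroup ((E → ℝ) → ℤ) :=
  AddSubgroup.closure (Set.range fun M : MatroidOn E => polytopeIndicator M)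

/-- The group of all integer combinations of indicator functions of relative interiors of base
polytopes of matroids on `E`. -/
def interiorIndicatorGroup {α : Type u} (E : Set α) : AddSubgroup ((E → ℝ) → ℤ) :=
  AddSubgroup.closure (Set.range fun M : MatroidOn E => interiorIndicator M)

/-- `f` is a valuation: it factors through the indicator functions of base polytopes by a
homomorphism of abelian groups. -/
def IsValuation {α : Type u} {E : Set α} {A : Type v} [AddCommGroup A]
    (f : MatroidOn E → A) : Prop :=
  ∃ F : indicatorGroup E →+ A, ∀ M : MatroidOn E,
    f M = F ⟨polytopeIndicator M, AddSubgroup.subset_closure (Set.mem_range_self M)⟩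

/-- `f` is a covaluation: it factors through the indicator functions of the relative interiors of
base polytopes by a homomorphism of abelian groups. -/
def IsCovaluation {α : Type u} {E : Set α} {A : Type v} [AddCommGroup A]
    (f : MatroidOn E → A) : Prop :=
  ∃ F : interiorIndicatorGroup E →+ A, ∀ M : MatroidOn E,
    f M = F ⟨interiorIndicator M, AddSubgroup.subset_closure (Set.mem_range_self M)⟩

/-! ### Series-parallel matroids and direct sums -/

/-- `N` is obtained from `M` by adding one new element `f` parallel to some element `e` of `M`;
parallel means that `{e, f}` is a circuit. -/
def IsParallelExtension {α : Type u} (M N : Matroid α) : Prop :=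
  ∃ e ∈ M.E, ∃ f, f ∉ M.E ∧ N.E = insert f M.E ∧ N.delete {f} = M ∧ N.IsCircuit {e, f}

/-- The dual operation. -/
def IsSeriesExtension {α : Type u} (M N : Matroid α) : Prop :=
  IsParallelExtension M.dual N.dual

/-- Series-parallel matroids: those obtained from a single coloop (a copy of `U_{1,1}`) by
parallel and series extensions. -/
inductive IsSeriesParallel {α : Type u} : Matroid α → Prop
  | coloop (e : α) : IsSeriesParallel (Matroid.freeOn {e})
  | parallel {M N : Matroid α} (hM : IsSeriesParallel M) (h : IsParallelExtension M N) :
      IsSeriesParallel N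
  | series {M N : Matroid α} (hM : IsSeriesParallel M) (h : IsSeriesExtension M N) :
      IsSeriesParallel N

/-- `M` is not a direct sum of two non-empty matroids. -/
def IsConnected {α : Type u} (M : Matroid α) : Prop :=
  ¬ ∃ (N₁ N₂ : Matroid α) (h : Disjoint N₁.E N₂.E),
    N₁.E.Nonempty ∧ N₂.E.Nonempty ∧ M = N₁.disjointSum N₂ h

/-- `M` is the direct sum of `m` matroids (on disjoint ground sets) all satisfying `P`. -/
def IsDirectSumOf {α : Type u} (P : Matroid α → Prop) (m : ℕ) (M : Matroid α) : Prop :=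
  ∃ (N : Fin m → Matroid α) (h : Pairwise (Function.onFun Disjoint fun i => (N i).E)),
    (∀ i, P (N i)) ∧ M = Matroid.disjointSigma N h

/-- `M` is a direct sum of finitely many matroids, each of which is series-parallel or a
single loop (a copy of `U_{0,1}`). -/
def IsSeriesParallelLoopSum {α : Type u} (M : Matroid α) : Prop :=
  ∃ m, IsDirectSumOf (fun N => IsSeriesParallel N ∨ ∃ e, N = Matroid.loopyOn {e}) m M

/-! ### Speyer's invariant -/

/-- Matroids whose ground set is a finite set of positive integers. -/
abbrev FinMatroid : Type := {M : Matroid ℕ+ // M.E.Finite}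

/-- The restriction of a map on all matroids to the matroids with a fixed finite ground set. -/
def restrictTo {A : Type v} (g : FinMatroid → A) {E : Set ℕ+} (hE : E.Finite) :
    MatroidOn E → A :=
  fun M => g ⟨M.1, M.2.symm ▸ hE⟩

/-- Isomorphism of matroids: a bijection of ground sets carrying one matroid to the other. -/
def AreIsomorphic {α : Type u} (M N : Matroid α) : Prop :=
  ∃ φ : M.E ≃ N.E, M.mapSetEquiv φ = N

/-- The properties that characterize Speyer's `g`-invariant: it is an isomorphism invariant, it is
covaluative, it vanishes on matroids with loops, and it equals `t ^ m` on direct sums of `m`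
connected series-parallel matroids. -/
structure IsSpeyerInvariant (g : FinMatroid → Polynomial ℤ) : Prop where
  invariant : ∀ M N : FinMatroid, AreIsomorphic M.1 N.1 → g M = g N
  covaluative : ∀ (E : Set ℕ+) (hE : E.Finite), IsCovaluation (restrictTo g hE)
  loops : ∀ M : FinMatroid, (∃ e, M.1.IsLoop e) → g M = 0
  seriesParallel : ∀ (M : FinMatroid) (m : ℕ),
    IsDirectSumOf (fun N => IsConnected N ∧ IsSeriesParallel N) m M.1 → g M = Polynomial.X ^ m

end MatroidSpan

/-!
The polytope of a matroid is cut into base polytopes of direct sums of series-parallel matroids and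
loops by means of lattice paths.

By Edmonds, the base polytope of `M` is the set of points `x` of the cube with `x(E) = r(E)` and
`x(X) ≤ r(X)` for all `X ⊆ E` (`basePolytope_eq_rankPolytope`). If `x` violates some of these
inequalities, then submodularity of `r` shows that the sets with `x(X) > r(X)` are stable under
union with a most violated set, and hence that the alternating sum over the chains of violated sets
vanishes (`sum_chains_eq_zero`). So the indicator function of the base polytope is an alternating
sum, over chains, of indicator functions of sets that are defined by inequalities along a chain only
(`indZ_submodular_eq_sum`).

Along a chain one may enumerate `E` so that the members of the chain are initial segments, and `x`
becomes the sequence of increments of a real-valued path whose partial heights are bounded by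
integers: a point of a `pathPolytope`. Cutting every range of heights at the integers leaves paths
which at each time have heights in an interval of length at most one (`Step.Narrow`,
`indZ_rankPolytope_mem`). The integral points of such a polytope are the bases of a direct sum of
series-parallel matroids and loops (`hasPathMatroid_of_narrow`): at each time only two heights are
possible, so that the last step of the path is a loop or a coloop, or is parallel or in series to
the step before it, or the step before it is forced and can be removed. All the polytopes involved
are integral, because every point with a fractional coordinate lies inside a segment of the polytope
(`eq_convexHull_of_perturb`). This proves the first part, and the second follows.

For covaluations, narrow path polytopes are further decomposed into their relatively open pieces,
which are relative interiors of path polytopes of the same kind (`intrinsicInterior_pathPolytope`).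
So the indicator function of a base polytope is a combination of those of relative interiors of base
polytopes of series-parallel sums. As the proper faces of a base polytope are base polytopes of
matroids with fewer bases (`exists_basePolytope_eq_face`), induction on the number of bases gives
the same for the indicator function of the relative interior (`interiorIndicator_mem_closure`).
A function with the properties of Speyer's invariant is prescribed on these sums: they have a loop,
or else are direct sums of series-parallel matroids, which are connected
(`IsSeriesParallel.isConnected`).
-/

namespace MatroidSpan

/-! ### Alternating sums over chains and submodular functions -/

open Finset in
/-- The alternating sum over the chains of a finite family of sets closed under union with a fixed
member vanishes. -/
theorem sum_chains_eq_zero {ι : Type*} [DecidableEq ι] [Fintype ι] (𝓑 : Set (Finset ι))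
    (X₀ : Finset ι) (h₀ : X₀ ∈ 𝓑) (hU : ∀ Y ∈ 𝓑, Y ∪ X₀ ∈ 𝓑)
    (𝒞 : Finset (Finset (Finset ι)))
    (h𝒞 : ∀ C, C ∈ 𝒞 ↔ IsChain (· ⊆ ·) (C : Set (Finset ι)) ∧ ∀ Y ∈ C, Y ∈ 𝓑) :
    ∑ C ∈ 𝒞, (-1 : ℤ) ^ #C = 0 := by
  classical
  -- adding or removing `Z C` is a sign-reversing involution on the chains
  let Z : Finset (Finset ι) → Finset ι := fun C => (C.filter fun Y => ¬ X₀ ⊆ Y).sup id ∪ X₀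
  let tog : Finset (Finset ι) → Finset (Finset ι) := fun C =>
    if Z C ∈ C then C.erase (Z C) else insert (Z C) C
  have hXZ : ∀ C, X₀ ⊆ Z C := fun C => subset_union_right
  have hfilter : ∀ C, (tog C).filter (fun Y => ¬ X₀ ⊆ Y) = C.filter fun Y => ¬ X₀ ⊆ Y := by
    intro C
    ext Y
    have := hXZ C
    simp only [tog]
    split_ifs with h <;> simp only [mem_filter, mem_erase, mem_insert] <;> grind
  have hZtog : ∀ C, Z (tog C) = Z C := by
    intro C
    simp only [Z, hfilter]
  -- the union of a chain of members not containing `X₀` is the largest such member, or empty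
  have hsup : ∀ C : Finset (Finset ι), IsChain (· ⊆ ·) (C : Set (Finset ι)) →
      (C.filter fun Y => ¬ X₀ ⊆ Y).sup id = ∅ ∨
      (C.filter fun Y => ¬ X₀ ⊆ Y).sup id ∈ C.filter fun Y => ¬ X₀ ⊆ Y := by
    intro C hC
    rcases (C.filter fun Y => ¬ X₀ ⊆ Y).eq_empty_or_nonempty with he | hne
    · left; rw [he]; rfl
    · right
      have hdir : ∀ a ∈ (C.filter fun Y => ¬ X₀ ⊆ Y), ∀ b ∈ (C.filter fun Y => ¬ X₀ ⊆ Y),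
          a ∪ b ∈ (C.filter fun Y => ¬ X₀ ⊆ Y) := by
        intro a ha b hb
        rcases hC.total (mem_coe.2 (mem_filter.1 ha).1) (mem_coe.2 (mem_filter.1 hb).1) with h | h
        · rwa [union_eq_right.2 h]
        · rwa [union_eq_left.2 h]
      have := Finset.sup'_mem (s := ((C.filter fun Y => ¬ X₀ ⊆ Y : Finset _) : Set (Finset ι)))
        (fun a ha b hb => hdir a ha b hb) (C.filter fun Y => ¬ X₀ ⊆ Y) hne id (fun i hi => hi)
      rwa [Finset.sup'_eq_sup] at this
  have hZmem : ∀ C ∈ 𝒞, Z C ∈ 𝓑 := by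
    intro C hC
    obtain ⟨hc, hb⟩ := (h𝒞 C).1 hC
    rcases hsup C hc with h | h
    · simp only [Z, h, empty_union]; exact h₀
    · exact hU _ (hb _ (mem_filter.1 h).1)
  have hZcomp : ∀ C ∈ 𝒞, ∀ Y ∈ C, Y ⊆ Z C ∨ Z C ⊆ Y := by
    intro C hC Y hY
    obtain ⟨hc, hb⟩ := (h𝒞 C).1 hC
    by_cases hXY : X₀ ⊆ Y
    · right
      refine union_subset (Finset.sup_le fun W hW => ?_) hXY
      rcases hc.total (mem_coe.2 (mem_filter.1 hW).1) (mem_coe.2 hY) with h | h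
      · exact h
      · exact absurd (hXY.trans h) (mem_filter.1 hW).2
    · left
      exact (Finset.le_sup (f := id) (mem_filter.2 ⟨hY, hXY⟩)).trans subset_union_left
  refine Finset.sum_involution (fun C _ => tog C) ?_ ?_ ?_ ?_
  · intro C hC
    by_cases h : Z C ∈ C
    · simp only [tog, if_pos h]
      rw [← card_erase_add_one h, pow_succ]; ring
    · simp only [tog, if_neg h]
      rw [card_insert_of_notMem h, pow_succ]; ring
  · intro C hC _ heq
    by_cases h : Z C ∈ C
    · simp only [tog, if_pos h] at heq
      have h2 := notMem_erase (Z C) C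
      rw [heq] at h2
      exact h2 h
    · simp only [tog, if_neg h] at heq
      have h2 := mem_insert_self (Z C) C
      rw [heq] at h2
      exact h h2
  · intro C hC
    have hm := hZmem C hC
    have hcomp := hZcomp C hC
    obtain ⟨hc, hb⟩ := (h𝒞 C).1 hC
    rw [h𝒞]
    by_cases h : Z C ∈ C
    · simp only [tog, if_pos h]
      refine ⟨hc.mono ?_, fun Y hY => hb Y (mem_of_mem_erase hY)⟩
      exact_mod_cast erase_subset _ _
    · simp only [tog, if_neg h]
      refine ⟨?_, fun Y hY => ?_⟩
      · rw [coe_insert]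
        exact hc.insert fun Y hY _ => (hcomp Y hY).symm
      · rcases mem_insert.1 hY with rfl | hY
        · exact hm
        · exact hb Y hY
  · intro C hC
    by_cases h : Z C ∈ C
    · have : tog C = C.erase (Z C) := by simp only [tog, if_pos h]
      have h2 : Z C ∉ tog C := by rw [this]; exact notMem_erase _ _
      show (if Z (tog C) ∈ tog C then _ else _) = C
      rw [hZtog, if_neg h2, this, insert_erase h]
    · have : tog C = insert (Z C) C := by simp only [tog, if_neg h]
      have h2 : Z C ∈ tog C := by rw [this]; exact mem_insert_self _ _
      show (if Z (tog C) ∈ tog C then _ else _) = C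
      rw [hZtog, if_pos h2, this, erase_insert h]

/-- The integer-valued indicator function of a set. -/
noncomputable def indZ {β : Type*} (s : Set β) : β → ℤ := s.indicator fun _ => 1

theorem indZ_of_mem {β : Type*} {s : Set β} {x : β} (h : x ∈ s) : indZ s x = 1 :=
  Set.indicator_of_mem h _

theorem indZ_of_notMem {β : Type*} {s : Set β} {x : β} (h : x ∉ s) : indZ s x = 0 :=
  Set.indicator_of_notMem h _

@[simp] theorem indZ_empty {β : Type*} : indZ (∅ : Set β) = 0 := Set.indicator_empty _

theorem indZ_inter_notMem {β : Type*} (s t : Set β) : indZ (s ∩ tᶜ) = indZ s - indZ (s ∩ t) := by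
  funext x
  by_cases hs : x ∈ s <;> by_cases ht : x ∈ t <;> simp [indZ, hs, ht]

/-- The violated inequalities along a chain `C` can be traded, one at a time, for satisfied ones on
subchains, since `1_{S ∩ Tᶜ} = 1_S - 1_{S ∩ T}`. -/
theorem indZ_mem_of_chains {ι β : Type*} [DecidableEq ι] (G : AddSubgroup (β → ℤ))
    (H : Finset ι → Set β) (S : Set β)
    (hG : ∀ D : Finset (Finset ι), IsChain (· ⊆ ·) (D : Set (Finset ι)) →
      indZ (S ∩ {x | ∀ X ∈ D, x ∈ H X}) ∈ G) (C : Finset (Finset ι)) :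
    ∀ D : Finset (Finset ι), IsChain (· ⊆ ·) ((C ∪ D : Finset (Finset ι)) : Set (Finset ι)) →
      indZ (S ∩ {x | ∀ X ∈ D, x ∈ H X} ∩ {x | ∀ X ∈ C, x ∉ H X}) ∈ G := by
  induction C using Finset.induction_on with
  | empty => intro D hD; simpa using hG D (by simpa using hD)
  | insert X C hX ih =>
    intro D hD
    have h1 := ih D (hD.mono (by
      exact_mod_cast Finset.union_subset_union_left (Finset.subset_insert _ _)))
    have h2 := ih (insert X D) (by rwa [Finset.union_insert, ← Finset.insert_union])
    have : indZ (S ∩ {x | ∀ Y ∈ D, x ∈ H Y} ∩ {x | ∀ Y ∈ insert X C, x ∉ H Y}) =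
        indZ (S ∩ {x | ∀ Y ∈ D, x ∈ H Y} ∩ {x | ∀ Y ∈ C, x ∉ H Y}) -
        indZ (S ∩ {x | ∀ Y ∈ insert X D, x ∈ H Y} ∩ {x | ∀ Y ∈ C, x ∉ H Y}) := by
      have h3 : S ∩ {x | ∀ Y ∈ insert X D, x ∈ H Y} ∩ {x | ∀ Y ∈ C, x ∉ H Y} =
          S ∩ {x | ∀ Y ∈ D, x ∈ H Y} ∩ {x | ∀ Y ∈ C, x ∉ H Y} ∩ H X := by
        ext x; simp; tauto
      rw [h3, ← indZ_inter_notMem]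
      congr 1
      ext x; simp; tauto
    rw [this]
    exact sub_mem h1 h2

open Finset in
/-- The indicator function of the points satisfying all inequalities `x(X) ≤ r(X)` of a submodular
function is the alternating sum, over chains of sets, of the indicator functions of the points that
violate every inequality along the chain. -/
theorem indZ_submodular_eq_sum {ι : Type*} [DecidableEq ι] [Fintype ι] (r : Finset ι → ℝ)
    (hr : ∀ X Y, r (X ∩ Y) + r (X ∪ Y) ≤ r X + r Y) (S : Set (ι → ℝ))
    (𝒞 : Finset (Finset (Finset ι)))
    (h𝒞 : ∀ C, C ∈ 𝒞 ↔ IsChain (· ⊆ ·) (C : Set (Finset ι))) :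
    indZ (S ∩ {x | ∀ X, ∑ i ∈ X, x i ≤ r X}) =
      ∑ C ∈ 𝒞, (-1 : ℤ) ^ #C • indZ (S ∩ {x | ∀ X ∈ C, ¬ ∑ i ∈ X, x i ≤ r X}) := by
  classical
  funext x
  rw [Finset.sum_apply]
  by_cases hS : x ∈ S
  swap
  · simp [indZ, hS]
  have hsum : ∑ C ∈ 𝒞, ((-1 : ℤ) ^ #C • indZ (S ∩ {x | ∀ X ∈ C, ¬ ∑ i ∈ X, x i ≤ r X})) x =
      ∑ C ∈ 𝒞.filter (fun C => ∀ X ∈ C, ¬ ∑ i ∈ X, x i ≤ r X), (-1 : ℤ) ^ #C := by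
    rw [Finset.sum_filter]
    refine Finset.sum_congr rfl fun C _ => ?_
    by_cases h : ∀ X ∈ C, ¬ ∑ i ∈ X, x i ≤ r X
    · have hm : x ∈ S ∩ {x | ∀ X ∈ C, ¬ ∑ i ∈ X, x i ≤ r X} := ⟨hS, h⟩
      rw [if_pos h, Pi.smul_apply, indZ_of_mem hm]; simp
    · rw [if_neg h, Pi.smul_apply, indZ_of_notMem (fun h' => h h'.2)]; simp
  rw [hsum]
  by_cases hall : ∀ X, ∑ i ∈ X, x i ≤ r X
  · have hm : x ∈ S ∩ {x | ∀ X, ∑ i ∈ X, x i ≤ r X} := ⟨hS, hall⟩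
    rw [indZ_of_mem hm]
    have : 𝒞.filter (fun C => ∀ X ∈ C, ¬ ∑ i ∈ X, x i ≤ r X) = {∅} := by
      ext C
      simp only [mem_filter, mem_singleton, h𝒞]
      constructor
      · rintro ⟨-, h⟩
        exact eq_empty_of_forall_notMem fun X hX => h X hX (hall X)
      · rintro rfl; simp
    rw [this]; simp
  · rw [indZ_of_notMem (fun h => hall h.2)]
    -- by submodularity, union with a most violated set `X₀` preserves violated sets
    obtain ⟨X₀, -, hmin⟩ := Finset.exists_min_image (univ : Finset (Finset ι))
      (fun X => r X - ∑ i ∈ X, x i) ⟨∅, mem_univ _⟩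
    push Not at hall
    obtain ⟨X₁, hX₁⟩ := hall
    have h0 : r X₀ < ∑ i ∈ X₀, x i := by
      have := hmin X₁ (mem_univ _); linarith
    symm
    refine sum_chains_eq_zero {X | ¬ ∑ i ∈ X, x i ≤ r X} X₀ (not_le.2 h0) ?_ _ ?_
    · intro Y hY
      have h1 := hr Y X₀
      have h2 := hmin (Y ∩ X₀) (mem_univ _)
      have h3 := Finset.sum_union_inter (s₁ := Y) (s₂ := X₀) (f := x)
      have h4 : r Y < ∑ i ∈ Y, x i := not_le.1 hY
      show ¬ _
      rw [not_le]; linarith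
    · intro C
      simp [h𝒞]

/-! ### Integral polytopes in the cube -/

section Integrality

open Filter Topology

theorem eventually_add_mul_le {c d w : ℝ} (h : c ≤ d) (hw : c = d → w = 0) :
    ∀ᶠ ε in 𝓝 (0 : ℝ), c + ε * w ≤ d := by
  rcases h.eq_or_lt with h | h
  · filter_upwards with ε
    rw [hw h]; linarith
  · have : Tendsto (fun ε : ℝ => c + ε * w) (𝓝 0) (𝓝 (c + 0 * w)) :=
      (continuous_const.add (continuous_id.mul continuous_const)).tendsto 0
    rw [zero_mul, add_zero] at this
    filter_upwards [this.eventually_lt_const h] with ε hε using hε.le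

/-- A compact convex subset of the cube is the convex hull of its `0/1` points, provided that
through every other point there is a segment of the set having that point in its interior. -/
theorem eq_convexHull_of_perturb {ι : Type*} [Finite ι] {K : Set (ι → ℝ)} (hcomp : IsCompact K)
    (hconv : Convex ℝ K)
    (hpert : ∀ x ∈ K, (∃ i, x i ≠ 0 ∧ x i ≠ 1) →
      ∃ v : ι → ℝ, v ≠ 0 ∧ ∀ᶠ ε in 𝓝 (0 : ℝ), x + ε • v ∈ K) :
    K = convexHull ℝ {x ∈ K | ∀ i, x i = 0 ∨ x i = 1} := by
  refine Set.Subset.antisymm ?_ (convexHull_min (fun x hx => hx.1) hconv)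
  have hext : K.extremePoints ℝ ⊆ {x ∈ K | ∀ i, x i = 0 ∨ x i = 1} := by
    intro x hx
    obtain ⟨hxK, hx⟩ := mem_extremePoints.1 hx
    refine ⟨hxK, ?_⟩
    by_contra hcon
    push Not at hcon
    obtain ⟨v, hv, hev⟩ := hpert x hxK hcon
    have hneg : Tendsto (fun ε : ℝ => -ε) (𝓝 0) (𝓝 0) := by
      simpa using (continuous_neg (G := ℝ)).tendsto 0
    have hboth := (hev.and (hneg.eventually hev)).filter_mono (nhdsWithin_le_nhds (s := Set.Ioi 0))
    obtain ⟨ε, ⟨h1, h2⟩, hε⟩ := (hboth.and self_mem_nhdsWithin).exists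
    have hε' : (0 : ℝ) < ε := hε
    have hseg : x ∈ openSegment ℝ (x + ε • v) (x + (-ε) • v) := by
      refine ⟨1 / 2, 1 / 2, by norm_num, by norm_num, by norm_num, ?_⟩
      funext i
      simp only [Pi.add_apply, Pi.smul_apply, smul_eq_mul]
      ring
    have := (hx _ h1 _ h2 hseg).1
    apply hv
    funext i
    have hi := congrFun this i
    simp only [Pi.add_apply, Pi.smul_apply, smul_eq_mul, add_eq_left, mul_eq_zero] at hi
    rcases hi with hi | hi
    · exact absurd hi hε'.ne'
    · exact hi
  have hfin : {x ∈ K | ∀ i, x i = 0 ∨ x i = 1}.Finite := by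
    refine (Set.Finite.pi' (t := fun _ : ι => ({0, 1} : Set ℝ)) fun _ => Set.toFinite _).subset ?_
    intro x hx i
    simpa using hx.2 i
  refine (closure_convexHull_extremePoints hcomp hconv).symm.subset.trans ?_
  exact closure_minimal (convexHull_mono hext) (hfin.isClosed_convexHull ℝ)

/-- The points of the cube with `x(univ) = r(univ)` that satisfy all inequalities `x(X) ≤ r(X)`. -/
def rankPolytope {ι : Type*} [Fintype ι] (r : Finset ι → ℤ) : Set (ι → ℝ) :=
  {x | ((∀ i, 0 ≤ x i) ∧ ∀ i, x i ≤ 1) ∧ ∑ i, x i = r Finset.univ} ∩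
    {x | ∀ X, ∑ i ∈ X, x i ≤ r X}

theorem exists_int_of_zero_or_one {ι : Type*} {s : Finset ι} {x : ι → ℝ}
    (h : ∀ i ∈ s, x i = 0 ∨ x i = 1) : ∃ m : ℤ, ∑ i ∈ s, x i = m := by
  classical
  refine ⟨∑ i ∈ s, if x i = 0 then 0 else 1, ?_⟩
  push_cast
  refine Finset.sum_congr rfl fun i hi => ?_
  rcases h i hi with h | h <;> simp [h]

theorem eq_zero_or_one_of_int {y : ℝ} (h0 : 0 ≤ y) (h1 : y ≤ 1) {m : ℤ} (h : y = m) :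
    y = 0 ∨ y = 1 := by
  have h2 : 0 ≤ m := by exact_mod_cast h ▸ h0
  have h3 : m ≤ 1 := by exact_mod_cast h ▸ h1
  have : m = 0 ∨ m = 1 := by omega
  rcases this with rfl | rfl <;> simp [h]

theorem isCompact_of_isClosed_of_cube {ι : Type*} [Finite ι] {K : Set (ι → ℝ)}
    (hK : IsClosed K) (h : ∀ x ∈ K, ∀ i, 0 ≤ x i ∧ x i ≤ 1) : IsCompact K := by
  refine (isCompact_univ_pi (s := fun _ : ι => Set.Icc (0 : ℝ) 1)
    fun _ => isCompact_Icc).of_isClosed_subset hK fun x hx i _ => h x hx i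

/-- Integrality of the polytope of an integer submodular function (Edmonds). -/
theorem rankPolytope_eq_convexHull {ι : Type*} [Fintype ι] [DecidableEq ι] (r : Finset ι → ℤ)
    (hr : ∀ X Y, r (X ∩ Y) + r (X ∪ Y) ≤ r X + r Y) :
    rankPolytope r = convexHull ℝ {x ∈ rankPolytope r | ∀ i, x i = 0 ∨ x i = 1} := by
  have hsumc : ∀ X : Finset ι, Continuous fun x : ι → ℝ => ∑ i ∈ X, x i := fun X =>
    continuous_finsetSum _ fun i _ => continuous_apply i
  apply eq_convexHull_of_perturb
  · refine isCompact_of_isClosed_of_cube ?_ fun x hx i => ⟨hx.1.1.1 i, hx.1.1.2 i⟩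
    have c1 : IsClosed {x : ι → ℝ | ∀ i, 0 ≤ x i} := by
      rw [Set.ofPred_forall]
      exact isClosed_iInter fun i => isClosed_le continuous_const (continuous_apply i)
    have c2 : IsClosed {x : ι → ℝ | ∀ i, x i ≤ 1} := by
      rw [Set.ofPred_forall]
      exact isClosed_iInter fun i => isClosed_le (continuous_apply i) continuous_const
    have c3 : IsClosed {x : ι → ℝ | ∀ X : Finset ι, ∑ i ∈ X, x i ≤ r X} := by
      rw [Set.ofPred_forall]
      exact isClosed_iInter fun X => isClosed_le (hsumc X) continuous_const
    exact ((c1.inter c2).inter (isClosed_eq (hsumc _) continuous_const)).inter c3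
  · rintro x ⟨⟨⟨hx0, hx1⟩, hxs⟩, hxr⟩ y ⟨⟨⟨hy0, hy1⟩, hys⟩, hyr⟩ a b ha hb hab
    have hs : ∀ X : Finset ι, ∑ i ∈ X, (a • x + b • y) i =
        a * ∑ i ∈ X, x i + b * ∑ i ∈ X, y i := by
      intro X
      simp [Finset.sum_add_distrib, Finset.mul_sum]
    have comb : ∀ {p q c : ℝ}, p ≤ c → q ≤ c → a * p + b * q ≤ c := by
      intro p q c hp hq
      calc a * p + b * q ≤ a * c + b * c := by gcongr
        _ = c := by rw [← add_mul, hab, one_mul]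
    refine ⟨⟨⟨fun i => ?_, fun i => ?_⟩, ?_⟩, fun X => ?_⟩
    · have := hx0 i
      have := hy0 i
      simp only [Pi.add_apply, Pi.smul_apply, smul_eq_mul]
      positivity
    · exact comb (hx1 i) (hy1 i)
    · rw [hs, hxs, hys, ← add_mul, hab, one_mul]
    · rw [hs]; exact comb (hxr X) (hyr X)
  · rintro x ⟨⟨⟨hx0, hx1⟩, hxs⟩, hxr⟩ ⟨i₀, hi₀⟩
    -- a smallest tight set containing a fractional coordinate
    obtain ⟨T, hT, hmin⟩ := Finset.exists_min_image
      (Finset.univ.filter fun T : Finset ι => ∑ i ∈ T, x i = r T ∧ ∃ i ∈ T, x i ≠ 0 ∧ x i ≠ 1)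
      Finset.card ⟨Finset.univ, by
        simp only [Finset.mem_filter, Finset.mem_univ, true_and]; exact ⟨hxs, i₀, hi₀⟩⟩
    simp only [Finset.mem_filter, Finset.mem_univ, true_and] at hT hmin
    obtain ⟨hTt, a, haT, ha⟩ := hT
    have hb : ∃ b ∈ T, b ≠ a ∧ (x b ≠ 0 ∧ x b ≠ 1) := by
      by_contra hcon
      push Not at hcon
      obtain ⟨m, hm⟩ := exists_int_of_zero_or_one (s := T.erase a) (x := x) (by
        intro i hi
        obtain ⟨h1, h2⟩ := Finset.mem_erase.1 hi
        by_cases h : x i = 0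
        · exact Or.inl h
        · exact Or.inr (hcon i h2 h1 h))
      have h1 := Finset.add_sum_erase T x haT
      have h2 : x a = ((r T - m : ℤ) : ℝ) := by push_cast; linarith
      rcases eq_zero_or_one_of_int (hx0 a) (hx1 a) h2 with h | h
      · exact ha.1 h
      · exact ha.2 h
    obtain ⟨b, hbT, hba, hb⟩ := hb
    have hsub : ∀ X : Finset ι, ∑ i ∈ X, x i = r X → ∀ c ∈ T, (x c ≠ 0 ∧ x c ≠ 1) → c ∈ X →
        T ⊆ X := by
      intro X hX c hcT hc hcX
      have h1 : (r (X ∩ T) : ℝ) + r (X ∪ T) ≤ r X + r T := by exact_mod_cast hr X T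
      have h2 := Finset.sum_union_inter (s₁ := X) (s₂ := T) (f := x)
      have h3 := hxr (X ∩ T)
      have h4 := hxr (X ∪ T)
      have h5 := hmin (X ∩ T) ⟨by linarith, c, Finset.mem_inter.2 ⟨hcX, hcT⟩, hc⟩
      exact Finset.inter_eq_right.1 (Finset.eq_of_subset_of_card_le Finset.inter_subset_right h5)
    -- by minimality of `T`, every tight set contains both or none of `a` and `b`
    let v : ι → ℝ := Pi.single a 1 - Pi.single b 1
    have hv : ∀ X : Finset ι, ∑ i ∈ X, v i =
        (if a ∈ X then 1 else 0) - (if b ∈ X then 1 else 0) := by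
      intro X
      simp [v, Finset.sum_sub_distrib]
    have hvi : ∀ i, (x i = 0 ∨ x i = 1) → v i = 0 := by
      intro i hi
      have h1 : i ≠ a := by rintro rfl; tauto
      have h2 : i ≠ b := by rintro rfl; tauto
      simp [v, h1, h2]
    have hsum : ∀ (X : Finset ι) (ε : ℝ), ∑ i ∈ X, (x + ε • v) i =
        ∑ i ∈ X, x i + ε * ∑ i ∈ X, v i := by
      intro X ε
      simp [Finset.sum_add_distrib, Finset.mul_sum]
    refine ⟨v, ?_, ?_⟩
    · intro h
      have := congrFun h a
      simp [v, hba.symm] at this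
    · have e1 : ∀ᶠ ε in 𝓝 (0 : ℝ), ∀ i, -x i + ε * (-v i) ≤ 0 :=
        eventually_all.2 fun i => eventually_add_mul_le (by linarith [hx0 i]) fun h => by
          rw [hvi i (Or.inl (by linarith))]; simp
      have e2 : ∀ᶠ ε in 𝓝 (0 : ℝ), ∀ i, x i + ε * (v i) ≤ 1 :=
        eventually_all.2 fun i => eventually_add_mul_le (hx1 i) fun h => hvi i (Or.inr h)
      have e3 : ∀ᶠ ε in 𝓝 (0 : ℝ), ∀ X : Finset ι, ∑ i ∈ X, x i + ε * ∑ i ∈ X, v i ≤ r X :=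
        eventually_all.2 fun X => eventually_add_mul_le (hxr X) fun h => by
          rw [hv]
          by_cases h1 : a ∈ X
          · rw [if_pos h1, if_pos (hsub X h a haT ha h1 hbT)]; simp
          · have h2 : b ∉ X := fun h2 => h1 (hsub X h b hbT hb h2 haT)
            rw [if_neg h1, if_neg h2]; simp
      filter_upwards [e1, e2, e3] with ε h1 h2 h3
      refine ⟨⟨⟨fun i => ?_, fun i => h2 i⟩, ?_⟩, fun X => ?_⟩
      · have := h1 i
        simp only [Pi.add_apply, Pi.smul_apply, smul_eq_mul]; linarith
      · rw [hsum, hv]; simp [hxs]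
      · rw [hsum]; exact h3 X

end Integrality

/-! ### Lattice path polytopes -/

section PathPolytopes

open Filter Topology

/-- One step of a lattice path, taken at the element `elt`: the height before the step is
constrained to `[lo, hi]`, and the increment to `[bot, top]`. -/
structure Step (β : Type*) where
  /-- the element at which the step is taken -/
  elt : β
  /-- lower bound for the height before the step -/
  lo : ℤ
  /-- upper bound for the height before the step -/
  hi : ℤ
  /-- lower bound for the increment -/
  bot : ℤ
  /-- upper bound for the increment -/
  top : ℤ

/-- The height reached after the steps of `L`, when the increments are given by `x`. The head of the
list is the last step. -/
def height {β R : Type*} [AddMonoid R] (x : β → R) (L : List (Step β)) : R :=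
  (L.map fun p => x p.elt).sum

@[simp] theorem height_nil {β R : Type*} [AddMonoid R] (x : β → R) : height x [] = 0 := rfl

@[simp] theorem height_cons {β R : Type*} [AddMonoid R] (x : β → R) (p : Step β)
    (L : List (Step β)) : height x (p :: L) = x p.elt + height x L := by
  simp [height]

/-- All steps satisfy the condition `c`, which may involve the height before the step and the
increment. -/
def Holds {β R : Type*} [AddMonoid R] (c : Step β → R → R → Prop) (x : β → R) :
    List (Step β) → Prop
  | [] => True
  | p :: L => c p (height x L) (x p.elt) ∧ Holds c x L

/-- The height before the step and the increment respect the bounds of the step. -/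
def Step.Closed {β R : Type*} [IntCast R] [LE R] (p : Step β) (y z : R) : Prop :=
  ((p.lo : R) ≤ y ∧ y ≤ p.hi) ∧ ((p.bot : R) ≤ z ∧ z ≤ p.top)

/-- The relative interior of the real interval `[a, b]`. -/
def relIoo (a b : ℤ) : Set ℝ := {y | (a = b ∧ y = a) ∨ ((a : ℝ) < y ∧ y < b)}

/-- The height before the step and the increment lie in the relative interiors of the intervals
allowed by the step. -/
def Step.Open {β : Type*} (p : Step β) (y z : ℝ) : Prop :=
  y ∈ relIoo p.lo p.hi ∧ z ∈ relIoo p.bot p.top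

/-- At most two heights are possible before the step, and the increment lies in `[0, 1]`. -/
def Step.Narrow {β : Type*} (p : Step β) : Prop := p.hi ≤ p.lo + 1 ∧ 0 ≤ p.bot ∧ p.top ≤ 1

/-- The polytope of increments of paths that respect the bounds of `L` and end at height `r`. -/
def pathPolytope {β : Type*} (L : List (Step β)) (r : ℤ) : Set (β → ℝ) :=
  {x | Holds Step.Closed x L} ∩ {x | height x L = r}

theorem height_congr {β R : Type*} [AddMonoid R] {x y : β → R} {L : List (Step β)}
    (h : ∀ p ∈ L, x p.elt = y p.elt) : height x L = height y L := by
  unfold height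
  congr 1
  exact List.map_congr_left h

theorem holds_congr {β R : Type*} [AddMonoid R] {c : Step β → R → R → Prop} {x y : β → R}
    {L : List (Step β)} (h : ∀ p ∈ L, x p.elt = y p.elt) : Holds c x L ↔ Holds c y L := by
  induction L with
  | nil => rfl
  | cons p L ih =>
    have h' : ∀ q ∈ L, x q.elt = y q.elt := fun q hq => h q (List.mem_cons_of_mem _ hq)
    simp only [Holds]
    rw [ih h', height_congr h', h p List.mem_cons_self]

theorem height_add_smul {β : Type*} (x v : β → ℝ) (a b : ℝ) (L : List (Step β)) :
    height (a • x + b • v) L = a * height x L + b * height v L := by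
  induction L with
  | nil => simp
  | cons p L ih => simp [ih]; ring

theorem continuous_height {β : Type*} (L : List (Step β)) :
    Continuous fun x : β → ℝ => height x L := by
  induction L with
  | nil => simpa using continuous_const
  | cons p L ih => simp only [height_cons]; exact (continuous_apply p.elt).add ih

theorem isClosed_pathPolytope {β : Type*} (L : List (Step β)) (r : ℤ) :
    IsClosed (pathPolytope L r) := by
  refine IsClosed.inter ?_ (isClosed_eq (continuous_height L) continuous_const)
  induction L with
  | nil => simp [Holds]
  | cons p L ih =>
    have hp : Continuous fun x : β → ℝ => x p.elt := continuous_apply _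
    have h1 := (isClosed_le (continuous_const (y := (p.lo : ℝ))) (continuous_height L)).inter
      (isClosed_le (continuous_height L) (continuous_const (y := (p.hi : ℝ))))
    have h2 := (isClosed_le (continuous_const (y := (p.bot : ℝ))) hp).inter
      (isClosed_le hp (continuous_const (y := (p.top : ℝ))))
    exact (h1.inter h2).inter ih

theorem convex_pathPolytope {β : Type*} (L : List (Step β)) (r : ℤ) :
    Convex ℝ (pathPolytope L r) := by
  have low : ∀ {a b p q c : ℝ}, 0 ≤ a → 0 ≤ b → a + b = 1 → c ≤ p → c ≤ q → c ≤ a * p + b * q := by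
    intro a b p q c ha hb hab hp hq
    calc c = a * c + b * c := by rw [← add_mul, hab, one_mul]
      _ ≤ a * p + b * q := by gcongr
  have upp : ∀ {a b p q c : ℝ}, 0 ≤ a → 0 ≤ b → a + b = 1 → p ≤ c → q ≤ c → a * p + b * q ≤ c := by
    intro a b p q c ha hb hab hp hq
    calc a * p + b * q ≤ a * c + b * c := by gcongr
      _ = c := by rw [← add_mul, hab, one_mul]
  refine Convex.inter ?_ ?_
  · intro x hx y hy a b ha hb hab
    show Holds _ _ _
    replace hx : Holds Step.Closed x L := hx
    replace hy : Holds Step.Closed y L := hy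
    induction L with
    | nil => trivial
    | cons p L ih =>
      obtain ⟨⟨⟨h1, h2⟩, h3, h4⟩, h5⟩ := hx
      obtain ⟨⟨⟨k1, k2⟩, k3, k4⟩, k5⟩ := hy
      refine ⟨⟨?_, ?_⟩, ih h5 k5⟩
      · rw [height_add_smul]
        exact ⟨low ha hb hab h1 k1, upp ha hb hab h2 k2⟩
      · exact ⟨low ha hb hab h3 k3, upp ha hb hab h4 k4⟩
  · intro x hx y hy a b ha hb hab
    show height _ _ = _
    replace hx : height x L = r := hx
    replace hy : height y L = r := hy
    rw [height_add_smul, hx, hy, ← add_mul, hab, one_mul]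

theorem Holds.mem_bounds {β : Type*} {L : List (Step β)} {x : β → ℝ}
    (h : Holds Step.Closed x L) : ∀ p ∈ L, (p.bot : ℝ) ≤ x p.elt ∧ x p.elt ≤ p.top := by
  induction L with
  | nil => simp
  | cons q L ih =>
    intro p hp
    rcases List.mem_cons.1 hp with rfl | hp
    · exact h.1.2
    · exact ih h.2 p hp

/-- All partial heights with the same nonintegral fractional part `θ` can be moved simultaneously
without violating the bounds. -/
theorem exists_perturb {β : Type*} {L : List (Step β)} (hL : (L.map Step.elt).Nodup)
    (x : β → ℝ) (hx : Holds Step.Closed x L) (θ : ℝ) (hθ : θ ≠ 0) :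
    ∃ v : β → ℝ, (∀ L₁, L₁ <:+ L → height v L₁ = if Int.fract (height x L₁) = θ then 1 else 0) ∧
      ∀ᶠ ε in 𝓝 (0 : ℝ), Holds Step.Closed (x + ε • v) L := by
  classical
  induction L with
  | nil =>
    refine ⟨0, ?_, Eventually.of_forall fun _ => trivial⟩
    intro L₁ hL₁
    rw [List.suffix_nil.1 hL₁]
    simp [hθ.symm]
  | cons p L ih =>
    simp only [List.map_cons, List.nodup_cons] at hL
    obtain ⟨v, hv, hev⟩ := ih hL.2 hx.2
    let δ : List (Step β) → ℝ := fun L₁ => if Int.fract (height x L₁) = θ then 1 else 0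
    let w : β → ℝ := Function.update v p.elt (δ (p :: L) - δ L)
    have hne : ∀ q ∈ L, q.elt ≠ p.elt := fun q hq h =>
      hL.1 (List.mem_map.2 ⟨q, hq, h⟩)
    have hwv : ∀ q ∈ L, w q.elt = v q.elt := fun q hq => by simp [w, hne q hq]
    have hwp : w p.elt = δ (p :: L) - δ L := by simp [w]
    have hwh : ∀ L₁, L₁ <:+ L → height w L₁ = δ L₁ := by
      intro L₁ h
      refine Eq.trans ?_ (hv L₁ h)
      exact height_congr fun q hq => hwv q (h.subset hq)
    refine ⟨w, ?_, ?_⟩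
    · intro L₁ h
      rcases List.suffix_cons_iff.1 h with rfl | h
      · rw [height_cons, hwh L List.suffix_rfl, hwp]; simp [δ]
      · exact hwh L₁ h
    · obtain ⟨⟨⟨h1, h2⟩, h3, h4⟩, h5⟩ := hx
      have hδ : ∀ m : ℤ, height x L = m → δ L = 0 := by
        intro m hm
        simp only [δ, hm, Int.fract_intCast, ite_eq_right_iff]
        exact fun h => absurd h.symm hθ
      have hδ' : ∀ m : ℤ, x p.elt = m → δ (p :: L) - δ L = 0 := by
        intro m hm
        simp [δ, hm]
      have e1 := eventually_add_mul_le (c := -height x L) (d := -(p.lo : ℝ)) (w := -δ L)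
        (by linarith) fun h => by rw [hδ p.lo (by linarith)]; simp
      have e2 := eventually_add_mul_le h2 (w := δ L) fun h => hδ p.hi h
      have e3 := eventually_add_mul_le (c := -x p.elt) (d := -(p.bot : ℝ)) (w := -w p.elt)
        (by linarith) fun h => by rw [hwp, hδ' p.bot (by linarith)]; simp
      have e4 := eventually_add_mul_le h4 (w := w p.elt) fun h => by rw [hwp]; exact hδ' p.top h
      filter_upwards [hev, e1, e2, e3, e4] with ε he h1 h2 h3 h4
      have hh : height (x + ε • w) L = height x L + ε * δ L := by
        have := height_add_smul x w 1 ε L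
        rw [one_smul, one_mul, hwh L List.suffix_rfl] at this
        exact this
      refine ⟨⟨⟨?_, ?_⟩, ?_, ?_⟩, ?_⟩
      · rw [hh]; linarith
      · rw [hh]; linarith
      · simp only [Pi.add_apply, Pi.smul_apply, smul_eq_mul]; linarith
      · simp only [Pi.add_apply, Pi.smul_apply, smul_eq_mul]; linarith
      · refine (holds_congr fun q hq => ?_).1 he
        simp [hwv q hq]

/-- Path polytopes in the cube are integral. -/
theorem pathPolytope_eq_convexHull {β : Type*} [Finite β] {L : List (Step β)} (r : ℤ)
    (hL : (L.map Step.elt).Nodup) (hmem : ∀ i, ∃ p ∈ L, p.elt = i)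
    (hn : ∀ p ∈ L, 0 ≤ p.bot ∧ p.top ≤ 1) :
    pathPolytope L r = convexHull ℝ {x ∈ pathPolytope L r | ∀ i, x i = 0 ∨ x i = 1} := by
  have hcube : ∀ x ∈ pathPolytope L r, ∀ i, 0 ≤ x i ∧ x i ≤ 1 := by
    rintro x ⟨hx, -⟩ i
    obtain ⟨p, hp, rfl⟩ := hmem i
    obtain ⟨h1, h2⟩ := hx.mem_bounds p hp
    have h3 : (0 : ℝ) ≤ p.bot := by exact_mod_cast (hn p hp).1
    have h4 : (p.top : ℝ) ≤ 1 := by exact_mod_cast (hn p hp).2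
    exact ⟨h3.trans h1, h2.trans h4⟩
  refine eq_convexHull_of_perturb
    (isCompact_of_isClosed_of_cube (isClosed_pathPolytope L r) hcube) (convex_pathPolytope L r) ?_
  rintro x hx ⟨i, hi⟩
  have hsuf : ∃ L₁, L₁ <:+ L ∧ Int.fract (height x L₁) ≠ 0 := by
    by_contra hcon
    push Not at hcon
    obtain ⟨p, hp, rfl⟩ := hmem i
    obtain ⟨s, t, rfl⟩ := List.append_of_mem hp
    have h1 := Int.fract_eq_iff.1 (hcon (p :: t) (List.suffix_append _ _))
    have h2 := Int.fract_eq_iff.1 (hcon t ((List.suffix_cons p t).trans (List.suffix_append _ _)))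
    obtain ⟨-, -, m, hm⟩ := h1
    obtain ⟨-, -, n, hn⟩ := h2
    rw [height_cons] at hm
    obtain ⟨h3, h4⟩ := hcube x hx p.elt
    rcases eq_zero_or_one_of_int h3 h4 (m := m - n) (by push_cast; linarith) with h | h
    · exact hi.1 h
    · exact hi.2 h
  obtain ⟨L₁, hL₁, hθ⟩ := hsuf
  obtain ⟨v, hv, hev⟩ := exists_perturb hL x hx.1 _ hθ
  refine ⟨v, ?_, ?_⟩
  · rintro rfl
    have := hv L₁ hL₁
    rw [if_pos rfl] at this
    have h0 : ∀ L : List (Step β), height (0 : β → ℝ) L = 0 := by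
      intro L
      induction L with
      | nil => rfl
      | cons p L ih => simp [ih]
    rw [h0] at this
    norm_num at this
  · filter_upwards [hev] with ε hε
    refine ⟨hε, ?_⟩
    show height _ _ = _
    have h1 := height_add_smul x v 1 ε L
    have h2 : height x L = r := hx.2
    rw [one_smul, one_mul, hv L List.suffix_rfl, h2, Int.fract_intCast, if_neg hθ.symm] at h1
    rw [h1]; simp

/-! ### Refining the steps -/

/-- Pulling back an integer-valued function along `g` and multiplying by `w`. -/
def mulComp {γ δ : Type*} (g : γ → δ) (w : γ → ℤ) : (δ → ℤ) →+ (γ → ℤ) where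
  toFun u x := u (g x) * w x
  map_zero' := by funext; simp
  map_add' u v := by funext; simp [add_mul]

theorem mulComp_indZ {γ δ : Type*} (g : γ → δ) (s : Set δ) (t : Set γ) :
    mulComp g (indZ t) (indZ s) = indZ (g ⁻¹' s ∩ t) := by
  classical
  funext x
  simp only [mulComp, AddMonoidHom.coe_mk, ZeroHom.coe_mk, indZ, Set.indicator_apply,
    Set.mem_inter_iff, Set.mem_preimage]
  by_cases h1 : g x ∈ s <;> by_cases h2 : x ∈ t <;> simp [h1, h2]

/-- If an indicator function is a combination of others, then so are the pullbacks, restricted to a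
set. -/
theorem indZ_preimage_inter_mem {γ δ : Type*} {s : Set δ} {F : Set (Set δ)}
    (h : indZ s ∈ AddSubgroup.closure (indZ '' F)) (g : γ → δ) (t : Set γ)
    (G : AddSubgroup (γ → ℤ)) (hG : ∀ s' ∈ F, indZ (g ⁻¹' s' ∩ t) ∈ G) :
    indZ (g ⁻¹' s ∩ t) ∈ G := by
  have : AddSubgroup.closure (indZ '' F) ≤ G.comap (mulComp g (indZ t)) := by
    rw [AddSubgroup.closure_le]
    rintro _ ⟨s', hs', rfl⟩
    show mulComp _ _ _ ∈ G
    rw [mulComp_indZ]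
    exact hG s' hs'
  have := this h
  rwa [AddSubgroup.mem_comap, mulComp_indZ] at this

theorem height_eq_of_forall₂ {β R : Type*} [AddMonoid R] {Q : Step β → Step β → Prop}
    (hQ : ∀ p p', Q p p' → p'.elt = p.elt) {L L' : List (Step β)} (h : List.Forall₂ Q L L')
    (x : β → R) : height x L' = height x L := by
  induction h with
  | nil => rfl
  | cons hp _ ih => rw [height_cons, height_cons, ih, hQ _ _ hp]

theorem map_elt_eq_of_forall₂ {β : Type*} {Q : Step β → Step β → Prop}
    (hQ : ∀ p p', Q p p' → p'.elt = p.elt) {L L' : List (Step β)} (h : List.Forall₂ Q L L') :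
    L'.map Step.elt = L.map Step.elt := by
  induction h with
  | nil => rfl
  | cons hp _ ih => rw [List.map_cons, List.map_cons, ih, hQ _ _ hp]

theorem forall_of_forall₂ {γ : Type*} {Q : γ → γ → Prop} {a b : γ → Prop}
    (hQ : ∀ p p', Q p p' → a p → b p') {L L' : List γ} (h : List.Forall₂ Q L L')
    (ha : ∀ p ∈ L, a p) : ∀ p ∈ L', b p := by
  induction h with
  | nil => simp
  | cons hp _ ih =>
    intro q hq
    rcases List.mem_cons.1 hq with rfl | hq
    · exact hQ _ _ hp (ha _ List.mem_cons_self)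
    · exact ih (fun p hp => ha p (List.mem_cons_of_mem _ hp)) q hq

/-- If the condition at every step decomposes, then so does the condition on whole paths. -/
theorem indZ_holds_mem {β : Type*} {c c' : Step β → ℝ → ℝ → Prop} {Q : Step β → Step β → Prop}
    (hQ : ∀ p p', Q p p' → p'.elt = p.elt) {L : List (Step β)}
    (h : ∀ p ∈ L, indZ {q : ℝ × ℝ | c p q.1 q.2} ∈
      AddSubgroup.closure (indZ '' {s | ∃ p', Q p p' ∧ s = {q : ℝ × ℝ | c' p' q.1 q.2}}))
    (S : Set (β → ℝ)) (G : AddSubgroup ((β → ℝ) → ℤ))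
    (hG : ∀ L', List.Forall₂ Q L L' → indZ ({x | Holds c' x L'} ∩ S) ∈ G) :
    indZ ({x | Holds c x L} ∩ S) ∈ G := by
  induction L generalizing S with
  | nil => simpa [Holds] using hG [] List.Forall₂.nil
  | cons p L ih =>
    have e1 : {x | Holds c x (p :: L)} ∩ S =
        {x | Holds c x L} ∩ ({x : β → ℝ | c p (height x L) (x p.elt)} ∩ S) := by
      ext x; simp [Holds]; tauto
    rw [e1]
    refine ih (fun q hq => h q (List.mem_cons_of_mem _ hq)) _ fun L' hL' => ?_
    have e2 : {x | Holds c' x L'} ∩ ({x : β → ℝ | c p (height x L) (x p.elt)} ∩ S) =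
        (fun x : β → ℝ => (height x L', x p.elt)) ⁻¹' {q | c p q.1 q.2} ∩
          ({x | Holds c' x L'} ∩ S) := by
      ext x
      simp only [height_eq_of_forall₂ hQ hL']
      simp; tauto
    rw [e2]
    refine indZ_preimage_inter_mem (h p List.mem_cons_self) _ _ G ?_
    rintro _ ⟨p', hp', rfl⟩
    have := hG (p' :: L') (List.Forall₂.cons hp' hL')
    convert this using 2
    ext x
    simp only [Holds, ← hQ p p' hp']
    simp; tauto

theorem indZ_union_eq {β : Type*} (s t : Set β) :
    indZ (s ∪ t) = indZ s + indZ t - indZ (s ∩ t) := by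
  funext x
  by_cases hs : x ∈ s <;> by_cases ht : x ∈ t <;> simp [indZ, hs, ht]

/-- An integral interval decomposes into intervals of length at most one. -/
theorem indZ_Icc_mem_narrow (a b : ℤ) : indZ {y : ℝ | (a : ℝ) ≤ y ∧ y ≤ b} ∈ AddSubgroup.closure
    (indZ '' {s | ∃ a' b' : ℤ, b' ≤ a' + 1 ∧ s = {y : ℝ | (a' : ℝ) ≤ y ∧ y ≤ b'}}) := by
  obtain ⟨n, hn⟩ : ∃ n : ℕ, b ≤ a + 1 + n := ⟨(b - a - 1).toNat, by omega⟩
  induction n generalizing a with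
  | zero => exact AddSubgroup.subset_closure ⟨_, ⟨a, b, by omega, rfl⟩, rfl⟩
  | succ n ih =>
    by_cases hab : b ≤ a + 1
    · exact AddSubgroup.subset_closure ⟨_, ⟨a, b, hab, rfl⟩, rfl⟩
    have hab' : ((a + 1 : ℤ) : ℝ) ≤ b := by exact_mod_cast (by omega : a + 1 ≤ b)
    have haa : (a : ℝ) ≤ ((a + 1 : ℤ) : ℝ) := by push_cast; linarith
    have h1 : {y : ℝ | (a : ℝ) ≤ y ∧ y ≤ b} =
        {y : ℝ | (a : ℝ) ≤ y ∧ y ≤ ((a + 1 : ℤ) : ℝ)} ∪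
          {y : ℝ | ((a + 1 : ℤ) : ℝ) ≤ y ∧ y ≤ b} := by
      ext y
      simp only [Set.mem_ofPred_eq, Set.mem_union]
      constructor
      · rintro ⟨h1, h2⟩
        rcases le_total y ((a + 1 : ℤ) : ℝ) with h | h
        · exact Or.inl ⟨h1, h⟩
        · exact Or.inr ⟨h, h2⟩
      · rintro (⟨h1, h2⟩ | ⟨h1, h2⟩)
        · exact ⟨h1, h2.trans hab'⟩
        · exact ⟨haa.trans h1, h2⟩
    have h2 : {y : ℝ | (a : ℝ) ≤ y ∧ y ≤ ((a + 1 : ℤ) : ℝ)} ∩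
          {y : ℝ | ((a + 1 : ℤ) : ℝ) ≤ y ∧ y ≤ b} =
        {y : ℝ | ((a + 1 : ℤ) : ℝ) ≤ y ∧ y ≤ ((a + 1 : ℤ) : ℝ)} := by
      ext y
      simp only [Set.mem_ofPred_eq, Set.mem_inter_iff]
      exact ⟨fun h => ⟨h.2.1, h.1.2⟩, fun h => ⟨⟨haa.trans h.1, h.2⟩, h.1, h.2.trans hab'⟩⟩
    rw [h1, indZ_union_eq, h2]
    refine sub_mem (add_mem ?_ (ih (a + 1) (by push_cast at hn; omega))) ?_
    · exact AddSubgroup.subset_closure ⟨_, ⟨a, a + 1, le_rfl, rfl⟩, rfl⟩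
    · exact AddSubgroup.subset_closure ⟨_, ⟨a + 1, a + 1, by omega, rfl⟩, rfl⟩

/-- An interval is the disjoint union of the relative interiors of its faces. -/
theorem indZ_Icc_mem_relIoo (a b : ℤ) : indZ {y : ℝ | (a : ℝ) ≤ y ∧ y ≤ b} ∈ AddSubgroup.closure
    (indZ '' {s | ∃ a' b' : ℤ, a ≤ a' ∧ a' ≤ b' ∧ b' ≤ b ∧ s = relIoo a' b'}) := by
  rcases lt_trichotomy a b with hab | rfl | hab
  · have hab' : (a : ℝ) < b := by exact_mod_cast hab
    have h : indZ {y : ℝ | (a : ℝ) ≤ y ∧ y ≤ b} =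
        indZ (relIoo a b) + indZ (relIoo a a) + indZ (relIoo b b) := by
      classical
      funext y
      simp only [indZ, relIoo, Pi.add_apply, Set.indicator_apply, Set.mem_ofPred_eq, hab.ne,
        false_and, false_or, true_and]
      rcases lt_trichotomy y a with h1 | h1 | h1 <;> rcases lt_trichotomy y b with h2 | h2 | h2 <;>
        grind
    rw [h]
    refine add_mem (add_mem ?_ ?_) ?_
    · exact AddSubgroup.subset_closure ⟨_, ⟨a, b, le_rfl, hab.le, le_rfl, rfl⟩, rfl⟩
    · exact AddSubgroup.subset_closure ⟨_, ⟨a, a, le_rfl, le_rfl, hab.le, rfl⟩, rfl⟩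
    · exact AddSubgroup.subset_closure ⟨_, ⟨b, b, hab.le, le_rfl, le_rfl, rfl⟩, rfl⟩
  · refine AddSubgroup.subset_closure ⟨_, ⟨a, a, le_rfl, le_rfl, le_rfl, rfl⟩, ?_⟩
    congr 1
    ext y
    simp only [relIoo, Set.mem_ofPred_eq, true_and]
    constructor
    · rintro (rfl | h)
      · exact ⟨le_rfl, le_rfl⟩
      · exact ⟨h.1.le, h.2.le⟩
    · exact fun h => Or.inl (le_antisymm h.2 h.1)
  · have : {y : ℝ | (a : ℝ) ≤ y ∧ y ≤ b} = ∅ := by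
      ext y
      simp only [Set.mem_ofPred_eq, Set.mem_empty_iff_false, iff_false]
      rintro ⟨h1, h2⟩
      have : a ≤ b := by exact_mod_cast h1.trans h2
      omega
    rw [this, indZ_empty]
    exact zero_mem _

/-- Path polytopes decompose into path polytopes of narrow steps. -/
theorem indZ_pathPolytope_mem_narrow {β : Type*} (L : List (Step β)) (r : ℤ)
    (hn : ∀ p ∈ L, 0 ≤ p.bot ∧ p.top ≤ 1) (G : AddSubgroup ((β → ℝ) → ℤ))
    (hG : ∀ L' : List (Step β), L'.map Step.elt = L.map Step.elt → (∀ p ∈ L', p.Narrow) →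
      indZ (pathPolytope L' r) ∈ G) :
    indZ (pathPolytope L r) ∈ G := by
  refine indZ_holds_mem (c' := Step.Closed)
    (Q := fun p p' => p'.elt = p.elt ∧ ((0 ≤ p.bot ∧ p.top ≤ 1) → p'.Narrow))
    (fun p p' h => h.1) (fun p _ => ?_) _ G fun L' hL' => ?_
  · have e : {q : ℝ × ℝ | p.Closed q.1 q.2} = Prod.fst ⁻¹' {y : ℝ | (p.lo : ℝ) ≤ y ∧ y ≤ p.hi} ∩
        {q | (p.bot : ℝ) ≤ q.2 ∧ q.2 ≤ p.top} := rfl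
    rw [e]
    refine indZ_preimage_inter_mem (indZ_Icc_mem_narrow p.lo p.hi) _ _ _ ?_
    rintro _ ⟨a, b, hab, rfl⟩
    exact AddSubgroup.subset_closure
      ⟨_, ⟨⟨p.elt, a, b, p.bot, p.top⟩, ⟨rfl, fun h => ⟨hab, h⟩⟩, rfl⟩, rfl⟩
  · have hh := height_eq_of_forall₂ (R := ℝ) (fun p p' h => h.1) hL'
    have hmap := map_elt_eq_of_forall₂ (fun p p' h => h.1) hL'
    have hnar := forall_of_forall₂ (fun p p' h hp => h.2 hp) hL' hn
    have := hG L' hmap hnar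
    rw [pathPolytope] at this
    simpa only [hh] using this

/-- Path polytopes of narrow steps decompose into relatively open ones. -/
theorem indZ_pathPolytope_mem_open {β : Type*} (L : List (Step β)) (r : ℤ)
    (hn : ∀ p ∈ L, p.Narrow) (G : AddSubgroup ((β → ℝ) → ℤ))
    (hG : ∀ L' : List (Step β), L'.map Step.elt = L.map Step.elt → (∀ p ∈ L', p.Narrow) →
      indZ ({x | Holds Step.Open x L'} ∩ {x | height x L' = r}) ∈ G) :
    indZ (pathPolytope L r) ∈ G := by
  refine indZ_holds_mem (c' := Step.Open)
    (Q := fun p p' => p'.elt = p.elt ∧ (p.Narrow → p'.Narrow))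
    (fun p p' h => h.1) (fun p _ => ?_) _ G fun L' hL' => ?_
  · have e : {q : ℝ × ℝ | p.Closed q.1 q.2} = Prod.fst ⁻¹' {y : ℝ | (p.lo : ℝ) ≤ y ∧ y ≤ p.hi} ∩
        {q | (p.bot : ℝ) ≤ q.2 ∧ q.2 ≤ p.top} := rfl
    rw [e]
    refine indZ_preimage_inter_mem (indZ_Icc_mem_relIoo p.lo p.hi) _ _ _ ?_
    rintro _ ⟨a, b, h1, h2, h3, rfl⟩
    have e' : Prod.fst ⁻¹' relIoo a b ∩ {q : ℝ × ℝ | (p.bot : ℝ) ≤ q.2 ∧ q.2 ≤ p.top} =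
        Prod.snd ⁻¹' {z : ℝ | (p.bot : ℝ) ≤ z ∧ z ≤ p.top} ∩ {q | q.1 ∈ relIoo a b} :=
      Set.inter_comm _ _
    rw [e']
    refine indZ_preimage_inter_mem (indZ_Icc_mem_relIoo p.bot p.top) _ _ _ ?_
    rintro _ ⟨s, t, k1, k2, k3, rfl⟩
    refine AddSubgroup.subset_closure ⟨_, ⟨⟨p.elt, a, b, s, t⟩, ⟨rfl, fun h => ?_⟩, rfl⟩, ?_⟩
    · obtain ⟨n1, n2, n3⟩ := h
      exact ⟨by show b ≤ a + 1; omega, by show 0 ≤ s; omega, by show t ≤ 1; omega⟩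
    · congr 1
      exact Set.inter_comm _ _
  · have hh := height_eq_of_forall₂ (R := ℝ) (fun p p' h => h.1) hL'
    have hmap := map_elt_eq_of_forall₂ (fun p p' h => h.1) hL'
    have hnar := forall_of_forall₂ (fun p p' h hp => h.2 hp) hL' hn
    have := hG L' hmap hnar
    simpa only [hh] using this

end PathPolytopes

/-! ### From submodular inequalities to lattice paths -/

/-- A chain of subsets of `U` consists of the sets of final segments of a suitable enumeration of
`U`. -/
theorem exists_list_of_chain {ι : Type*} [DecidableEq ι] (U : Finset ι) :
    ∀ D : Finset (Finset ι), IsChain (· ⊆ ·) (D : Set (Finset ι)) → (∀ X ∈ D, X ⊆ U) →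
      ∃ l : List ι, l.Nodup ∧ l.toFinset = U ∧ ∀ X ∈ D, ∃ l₁, l₁ <:+ l ∧ l₁.toFinset = X := by
  induction hn : U.card generalizing U with
  | zero =>
    intro D _ hU
    obtain rfl := Finset.card_eq_zero.1 hn
    exact ⟨[], List.nodup_nil, rfl, fun X hX =>
      ⟨[], List.suffix_rfl, (Finset.subset_empty.1 (hU X hX)).symm⟩⟩
  | succ n ih =>
    intro D hD hU
    -- an element outside all proper members of the chain
    have ha : ∃ a ∈ U, ∀ X ∈ D, X ≠ U → a ∉ X := by
      rcases (D.erase U).eq_empty_or_nonempty with he | hne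
      · obtain ⟨a, ha⟩ := Finset.card_pos.1 (by omega : 0 < U.card)
        refine ⟨a, ha, fun X hX hXU => ?_⟩
        have : X ∈ D.erase U := Finset.mem_erase.2 ⟨hXU, hX⟩
        simp [he] at this
      · obtain ⟨W, hW, hmax⟩ := Finset.exists_max_image (D.erase U) Finset.card hne
        obtain ⟨hWU, hWD⟩ := Finset.mem_erase.1 hW
        obtain ⟨a, haU, haW⟩ := Finset.exists_of_ssubset ((hU W hWD).ssubset_of_ne hWU)
        refine ⟨a, haU, fun X hX hXU haX => haW ?_⟩
        rcases hD.total (Finset.mem_coe.2 hX) (Finset.mem_coe.2 hWD) with h | h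
        · exact h haX
        · have := Finset.eq_of_subset_of_card_le h (hmax X (Finset.mem_erase.2 ⟨hXU, hX⟩))
          rwa [this]
    obtain ⟨a, haU, ha⟩ := ha
    obtain ⟨l, hl, hlU, hlD⟩ := ih (U.erase a) (by rw [Finset.card_erase_of_mem haU]; omega)
      (D.erase U) (hD.mono (by exact_mod_cast Finset.erase_subset _ _)) (by
        intro X hX
        obtain ⟨h1, h2⟩ := Finset.mem_erase.1 hX
        exact Finset.subset_erase.2 ⟨hU X h2, ha X h2 h1⟩)
    have hal : a ∉ l := fun h => by
      have := List.mem_toFinset.2 h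
      simp [hlU] at this
    have hto : (a :: l).toFinset = U := by
      rw [List.toFinset_cons, hlU, Finset.insert_erase haU]
    refine ⟨a :: l, List.nodup_cons.2 ⟨hal, hl⟩, hto, fun X hX => ?_⟩
    by_cases hXU : X = U
    · exact ⟨a :: l, List.suffix_rfl, hto.trans hXU.symm⟩
    · obtain ⟨l₁, h1, h2⟩ := hlD X (Finset.mem_erase.2 ⟨hXU, hX⟩)
      exact ⟨l₁, h1.trans (List.suffix_cons _ _), h2⟩

/-- The path with steps at the elements of `l` whose height after the steps at the elements of `X`
is at most `b X`. -/
def upperSteps {ι : Type*} [DecidableEq ι] (b : Finset ι → ℤ) : List ι → List (Step ι)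
  | [] => []
  | a :: l => ⟨a, 0, b l.toFinset, 0, 1⟩ :: upperSteps b l

section upperSteps

variable {ι : Type*} [DecidableEq ι] (b : Finset ι → ℤ)

theorem map_elt_upperSteps (l : List ι) : (upperSteps b l).map Step.elt = l := by
  induction l with
  | nil => rfl
  | cons a l ih => simp [upperSteps, ih]

theorem upperSteps_bounds (l : List ι) : ∀ p ∈ upperSteps b l, 0 ≤ p.bot ∧ p.top ≤ 1 := by
  induction l with
  | nil => simp [upperSteps]
  | cons a l ih =>
    intro p hp
    rcases List.mem_cons.1 hp with rfl | hp
    · simp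
    · exact ih p hp

theorem height_upperSteps {l : List ι} (hl : l.Nodup) (x : ι → ℝ) :
    height x (upperSteps b l) = ∑ i ∈ l.toFinset, x i := by
  have : (upperSteps b l).map (fun p => x p.elt) = l.map x := by
    conv_rhs => rw [← map_elt_upperSteps b l, List.map_map]
    rfl
  rw [height, this, List.sum_toFinset x hl]

theorem holds_upperSteps {l : List ι} (hl : l.Nodup) (x : ι → ℝ) :
    Holds Step.Closed x (upperSteps b l) ↔ (∀ i ∈ l, 0 ≤ x i ∧ x i ≤ 1) ∧
      ∀ a l₁, a :: l₁ <:+ l → ∑ i ∈ l₁.toFinset, x i ≤ b l₁.toFinset := by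
  induction l with
  | nil => simp [upperSteps, Holds]
  | cons a l ih =>
    obtain ⟨hal, hl'⟩ := List.nodup_cons.1 hl
    simp only [upperSteps, Holds, Step.Closed, ih hl', height_upperSteps b hl']
    constructor
    · rintro ⟨⟨⟨h1, h2⟩, h3, h4⟩, h5, h6⟩
      refine ⟨?_, fun c l₁ h => ?_⟩
      · intro i hi
        rcases List.mem_cons.1 hi with rfl | hi
        · exact ⟨by exact_mod_cast h3, by exact_mod_cast h4⟩
        · exact h5 i hi
      · rcases List.suffix_cons_iff.1 h with h | h
        · obtain ⟨-, rfl⟩ := List.cons.inj h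
          exact h2
        · exact h6 c l₁ h
    · rintro ⟨h1, h2⟩
      refine ⟨⟨⟨?_, h2 a l List.suffix_rfl⟩, ?_, ?_⟩, fun i hi => h1 i (List.mem_cons_of_mem _ hi),
        fun c l₁ h => h2 c l₁ (h.trans (List.suffix_cons _ _))⟩
      · rw [Int.cast_zero]
        exact Finset.sum_nonneg fun i hi =>
          (h1 i (List.mem_cons_of_mem _ (List.mem_toFinset.1 hi))).1
      · simpa using (h1 a List.mem_cons_self).1
      · simpa using (h1 a List.mem_cons_self).2

end upperSteps

/-- The polytope of an integer submodular function is a combination of narrow path polytopes. -/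
theorem indZ_rankPolytope_mem {ι : Type*} [Fintype ι] [DecidableEq ι] (r : Finset ι → ℤ)
    (hr : ∀ X Y, r (X ∩ Y) + r (X ∪ Y) ≤ r X + r Y) (G : AddSubgroup ((ι → ℝ) → ℤ))
    (hG : ∀ L : List (Step ι), (L.map Step.elt).Nodup → (∀ i, i ∈ L.map Step.elt) →
      (∀ p ∈ L, p.Narrow) → indZ (pathPolytope L (r Finset.univ)) ∈ G) :
    indZ (rankPolytope r) ∈ G := by
  classical
  rw [rankPolytope, indZ_submodular_eq_sum (fun X => (r X : ℝ)) (by exact_mod_cast hr) _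
    (Finset.univ.filter fun C : Finset (Finset ι) => IsChain (· ⊆ ·) (C : Set (Finset ι)))
    (by simp)]
  refine sum_mem fun C hC => zsmul_mem ?_ _
  have hchain := (Finset.mem_filter.1 hC).2
  have := indZ_mem_of_chains G (fun X => {x : ι → ℝ | ∑ i ∈ X, x i ≤ r X})
    {x | ((∀ i, 0 ≤ x i) ∧ ∀ i, x i ≤ 1) ∧ ∑ i, x i = r Finset.univ} ?_ C ∅ (by simpa using hchain)
  · simpa using this
  intro D hD
  obtain ⟨l, hl, hlU, hlD⟩ := exists_list_of_chain Finset.univ D hD fun X _ => Finset.subset_univ X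
  -- the bound `X.card` is implied by `x ≤ 1`
  let b : Finset ι → ℤ := fun X => if X ∈ D then r X else X.card
  have hmem : ∀ i, i ∈ l := fun i => List.mem_toFinset.1 (hlU ▸ Finset.mem_univ i)
  have heq : {x : ι → ℝ | ((∀ i, 0 ≤ x i) ∧ ∀ i, x i ≤ 1) ∧ ∑ i, x i = r Finset.univ} ∩
      {x | ∀ X ∈ D, x ∈ {x : ι → ℝ | ∑ i ∈ X, x i ≤ r X}} =
      pathPolytope (upperSteps b l) (r Finset.univ) := by
    ext x
    simp only [pathPolytope, Set.mem_inter_iff, Set.mem_ofPred_eq, holds_upperSteps b hl,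
      height_upperSteps b hl, hlU]
    constructor
    · rintro ⟨⟨⟨h0, h1⟩, hs⟩, hD⟩
      refine ⟨⟨fun i _ => ⟨h0 i, h1 i⟩, fun a l₁ _ => ?_⟩, hs⟩
      by_cases h : l₁.toFinset ∈ D
      · simp only [b, if_pos h]; exact hD _ h
      · simp only [b, if_neg h]
        calc ∑ i ∈ l₁.toFinset, x i ≤ ∑ i ∈ l₁.toFinset, (1 : ℝ) :=
              Finset.sum_le_sum fun i _ => h1 i
          _ = _ := by simp
    · rintro ⟨⟨h0, h1⟩, hs⟩
      refine ⟨⟨⟨fun i => (h0 i (hmem i)).1, fun i => (h0 i (hmem i)).2⟩, hs⟩, fun X hX => ?_⟩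
      obtain ⟨l₁, ⟨s, hs₁⟩, rfl⟩ := hlD X hX
      rcases List.eq_nil_or_concat s with rfl | ⟨s', a, rfl⟩
      · rw [List.nil_append] at hs₁
        subst hs₁
        rw [hlU, hs]
      · have := h1 a l₁ ⟨s', by rw [← hs₁]; simp⟩
        simpa only [b, if_pos hX] using this
  rw [heq]
  refine indZ_pathPolytope_mem_narrow _ _ (upperSteps_bounds b l) G fun L' hL' hn => ?_
  rw [map_elt_upperSteps] at hL'
  exact hG L' (hL' ▸ hl) (hL' ▸ hmem) hn

/-! ### Parallel extensions, direct sums and duality -/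

section Extensions

open Set Matroid

variable {α : Type*} {M N : Matroid α} {e f : α}

theorem pair_sdiff_left (hne : e ≠ f) : ({e, f} : Set α) \ {e} = {f} := by
  rw [insert_sdiff_of_mem _ (mem_singleton e), sdiff_singleton_eq_self (by simpa using hne)]

theorem pair_sdiff_right (hne : e ≠ f) : ({e, f} : Set α) \ {f} = {e} := by
  rw [pair_comm, pair_sdiff_left hne.symm]

/-- Parallel elements are interchangeable in independent sets. -/
theorem indep_insert_iff_of_circuit_pair (hC : N.IsCircuit {e, f}) (hne : e ≠ f) {I : Set α}
    (heI : e ∉ I) (hfI : f ∉ I) : N.Indep (insert f I) ↔ N.Indep (insert e I) := by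
  by_cases hI : N.Indep I
  swap
  · exact iff_of_false (fun h => hI (h.subset (subset_insert _ _)))
      (fun h => hI (h.subset (subset_insert _ _)))
  have heE : e ∈ N.E := hC.subset_ground (by simp)
  have hfE : f ∈ N.E := hC.subset_ground (by simp)
  have h1 : f ∈ N.closure {e} := by
    have := hC.mem_closure_sdiff_singleton_of_mem (e := f) (by simp)
    rwa [pair_sdiff_right hne] at this
  have h2 : e ∈ N.closure {f} := by
    have := hC.mem_closure_sdiff_singleton_of_mem (e := e) (by simp)
    rwa [pair_sdiff_left hne] at this
  have key : f ∈ N.closure I ↔ e ∈ N.closure I := by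
    constructor
    · intro h
      exact N.closure_subset_closure_of_subset_closure (singleton_subset_iff.2 h) h2
    · intro h
      exact N.closure_subset_closure_of_subset_closure (singleton_subset_iff.2 h) h1
  rw [hI.insert_indep_iff_of_notMem hfI, hI.insert_indep_iff_of_notMem heI]
  simp [heE, hfE, key]

theorem indep_singletons_of_circuit_pair (hC : N.IsCircuit {e, f}) (hne : e ≠ f) :
    N.Indep {e} ∧ N.Indep {f} := by
  constructor
  · exact hC.ssubset_indep (by
      rw [ssubset_iff_of_subset (by simp)]; exact ⟨f, by simp, by simpa using hne.symm⟩)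
  · exact hC.ssubset_indep (by
      rw [ssubset_iff_of_subset (by simp)]; exact ⟨e, by simp, by simpa using hne⟩)

/-- A nonloop has a parallel extension, whose bases are the old ones and those obtained from them by
exchanging the two parallel elements. -/
theorem exists_parallelExtension (he : M.Indep {e}) (hf : f ∉ M.E) :
    ∃ N, IsParallelExtension M N ∧ N.E = insert f M.E ∧ ∀ B, N.IsBase B ↔
      (f ∉ B ∧ M.IsBase B) ∨ (f ∈ B ∧ e ∉ B ∧ M.IsBase (insert e (B \ {f}))) := by
  classical
  have heE : e ∈ M.E := by simpa using he.subset_ground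
  have hef : e ≠ f := fun h => hf (h ▸ heE)
  -- the extension is the preimage of `M` under the map that sends `f` to `e`
  let φ : α → α := Function.update id f e
  have φf : φ f = e := by simp [φ]
  have φne : ∀ x, x ≠ f → φ x = x := fun x hx => by simp [φ, hx]
  have hE : φ ⁻¹' M.E = insert f M.E := by
    ext x
    by_cases hx : x = f
    · subst hx; simp [φf, heE]
    · simp [φne x hx, hx]
  have himg : ∀ B, f ∉ B → φ '' B = B := fun B hB => by
    have : ∀ x ∈ B, φ x = id x := fun x hx => φne x fun h => hB (h ▸ hx)
    rw [image_congr this, image_id]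
  have himg' : ∀ B, f ∈ B → φ '' B = insert e (B \ {f}) := fun B hB => by
    conv_lhs => rw [← insert_sdiff_self_of_mem hB]
    rw [image_insert_eq, φf, himg _ (by simp)]
  have hinj : ∀ B, f ∉ B → InjOn φ B := fun B hB x hx y hy h => by
    rwa [φne x fun h => hB (h ▸ hx), φne y fun h => hB (h ▸ hy)] at h
  have hinj' : ∀ B, f ∈ B → (InjOn φ B ↔ e ∉ B) := fun B hB => by
    constructor
    · intro h heB
      exact hef (h heB hB (by rw [φf, φne e hef]))
    · intro heB x hx y hy h
      by_cases hxf : x = f <;> by_cases hyf : y = f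
      · rw [hxf, hyf]
      · rw [hxf, φf, φne y hyf] at h; exact absurd (h ▸ hy) heB
      · rw [hyf, φf, φne x hxf] at h; exact absurd (h ▸ hx) heB
      · rwa [φne x hxf, φne y hyf] at h
  have hEimg : φ '' (φ ⁻¹' M.E) = M.E := by
    rw [image_preimage_eq_iff]
    intro x hx
    exact ⟨x, φne x fun h => hf (h ▸ hx)⟩
  refine ⟨M.comap φ, ⟨e, heE, f, hf, hE, ?_, ?_⟩, hE, ?_⟩
  · refine ext_indep ?_ fun I _ => ?_
    · rw [delete_ground, comap_ground_eq, hE, insert_sdiff_self_of_notMem hf]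
    · rw [delete_indep_iff, comap_indep_iff, disjoint_singleton_right]
      constructor
      · rintro ⟨⟨h1, h2⟩, h3⟩
        rwa [himg _ h3] at h1
      · intro h
        have h3 : f ∉ I := fun h' => hf (h.subset_ground h')
        exact ⟨⟨by rwa [himg _ h3], hinj _ h3⟩, h3⟩
  · rw [isCircuit_iff_dep_forall_sdiff_singleton_indep, dep_iff, comap_indep_iff]
    refine ⟨⟨fun h => (hinj' _ (by simp)).1 h.2 (by simp), ?_⟩, ?_⟩
    · rw [comap_ground_eq, hE]
      exact insert_subset (Or.inr heE) (singleton_subset_iff.2 (Or.inl rfl))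
    · intro x hx
      rw [comap_indep_iff]
      rcases hx with rfl | hx
      · rw [pair_sdiff_left hef]
        exact ⟨by simpa [φf] using he, by simp⟩
      · rw [mem_singleton_iff.1 hx, pair_sdiff_right hef]
        exact ⟨by simpa [φne e hef] using he, by simp⟩
  · intro B
    rw [comap_isBase_iff, hEimg, isBasis_ground_iff, hE]
    by_cases hB : f ∈ B
    · rw [himg' _ hB, hinj' _ hB]
      simp only [hB, not_true, false_and, false_or, true_and]
      constructor
      · rintro ⟨h1, h2, -⟩; exact ⟨h2, h1⟩
      · rintro ⟨h1, h2⟩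
        refine ⟨h2, h1, fun x hx => ?_⟩
        by_cases hxf : x = f
        · exact Or.inl hxf
        · exact Or.inr (h2.subset_ground (Or.inr ⟨hx, hxf⟩))
    · rw [himg _ hB]
      simp only [hB, not_false_iff, true_and, false_and, or_false]
      exact ⟨fun h => h.1, fun h => ⟨h, hinj _ hB, h.subset_ground.trans (subset_insert _ _)⟩⟩

/-- The dual construction: a series extension along an element that is not a coloop. -/
theorem exists_seriesExtension (he : M✶.Indep {e}) (hf : f ∉ M.E) :
    ∃ N, IsSeriesExtension M N ∧ N.E = insert f M.E ∧ ∀ B ⊆ insert f M.E, N.IsBase B ↔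
      (f ∈ B ∧ M.IsBase (B \ {f})) ∨ (f ∉ B ∧ e ∈ B ∧ M.IsBase (B \ {e})) := by
  have heE : e ∈ M.E := by simpa using he.subset_ground
  have hef : e ≠ f := fun h => hf (h ▸ heE)
  obtain ⟨N, h1, h2, h3⟩ := exists_parallelExtension (M := M✶) he hf
  refine ⟨N✶, by rwa [IsSeriesExtension, dual_dual], by simpa using h2, fun B hB => ?_⟩
  have h2' : N.E = insert f M.E := h2
  rw [dual_isBase_iff (by rwa [h2']), h3, dual_isBase_iff', dual_isBase_iff', h2']
  by_cases hfB : f ∈ B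
  · have e1 : M.E \ (insert f M.E \ B) = B \ {f} := by
      ext x
      have := @hB x
      by_cases hx : x = f
      · subst hx; simp [hf]
      · simp [hx] at this ⊢; tauto
    have e2 : insert f M.E \ B ⊆ M.E := by
      rintro x ⟨rfl | hx, hxB⟩
      · exact absurd hfB hxB
      · exact hx
    have e3 : f ∉ insert f M.E \ B := fun h => h.2 hfB
    rw [e1]
    simp only [e2, e3, hfB, not_false_iff, not_true, true_and, and_true, false_and, or_false]
  · by_cases heB : e ∈ B
    · have e1 : M.E \ insert e ((insert f M.E \ B) \ {f}) = B \ {e} := by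
        ext x
        have := @hB x
        by_cases hx : x = f
        · subst hx; simp [hf, hfB]
        · simp [hx] at this ⊢; tauto
      have e2 : insert e ((insert f M.E \ B) \ {f}) ⊆ M.E := by
        rintro x (rfl | ⟨⟨rfl | hx, hxB⟩, hxf⟩)
        · exact heE
        · exact absurd rfl hxf
        · exact hx
      have e3 : f ∈ insert f M.E \ B := ⟨Or.inl rfl, hfB⟩
      have e4 : e ∉ insert f M.E \ B := fun h => h.2 heB
      rw [e1]
      simp only [e2, e3, e4, hfB, heB, not_false_iff, not_true, true_and, and_true,
        false_and, false_or]
    · simp [hfB, heB, heE]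

/-- A loop is parallel to nothing. -/
theorem IsParallelExtension.not_loopyOn (h : IsParallelExtension (loopyOn {e}) N) : False := by
  obtain ⟨e', he', f, hf, hE, hdel, hC⟩ := h
  have hne : e' ≠ f := fun h => hf (h ▸ he')
  have h1 := (indep_singletons_of_circuit_pair hC hne).1
  have h2 : (N.delete {f}).Indep {e'} := delete_indep_iff.2 ⟨h1, by simpa using hne⟩
  rw [hdel] at h2
  simp at h2

/-- The only parallel extension of a coloop is `U_{1,2}`, which is self-dual. -/
theorem dual_eq_self_of_parallelExtension_coloop (h : IsParallelExtension (freeOn {e}) N) :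
    N✶ = N := by
  obtain ⟨e', he', f, hf, hE, hdel, hC⟩ := h
  rw [freeOn_ground, mem_singleton_iff] at he'
  subst he'
  rw [freeOn_ground] at hf hE
  have hne : e' ≠ f := fun h => hf h.symm
  have hE' : N.E = {e', f} := by rw [hE, pair_comm]
  obtain ⟨h1, h2⟩ := indep_singletons_of_circuit_pair hC hne
  have hbase : ∀ B, N.IsBase B ↔ B = {e'} ∨ B = {f} := by
    have key : ∀ B, N.Indep B → B ⊆ {e'} ∨ B ⊆ {f} := by
      intro B hB
      by_cases he : e' ∈ B
      · left
        intro x hx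
        have := hE' ▸ hB.subset_ground hx
        rcases this with rfl | rfl
        · rfl
        · exact absurd (hB.subset (insert_subset he (singleton_subset_iff.2 hx))) hC.not_indep
      · right
        intro x hx
        have := hE' ▸ hB.subset_ground hx
        rcases this with rfl | rfl
        · exact absurd hx he
        · rfl
    intro B
    constructor
    · intro hB
      rcases key B hB.indep with h | h
      · exact Or.inl (hB.eq_of_subset_indep h1 h)
      · exact Or.inr (hB.eq_of_subset_indep h2 h)
    · rintro (rfl | rfl)
      · rw [isBase_iff_maximal_indep, maximal_subset_iff]
        refine ⟨h1, fun B hB hs => ?_⟩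
        rcases key B hB with h | h
        · exact hs.antisymm h
        · exact absurd (h (hs rfl)) hne
      · rw [isBase_iff_maximal_indep, maximal_subset_iff]
        refine ⟨h2, fun B hB hs => ?_⟩
        rcases key B hB with h | h
        · exact absurd (h (hs rfl)) hne.symm
        · exact hs.antisymm h
  refine ext_isBase rfl fun B hB => ?_
  rw [dual_isBase_iff', hbase, hbase, hE']
  replace hB : B ⊆ {e', f} := hE' ▸ hB
  rw [and_iff_left hB]
  have d1 := pair_sdiff_left hne
  have d2 := pair_sdiff_right hne
  constructor
  · rintro (h | h)
    · right; rw [← sdiff_sdiff_cancel_left hB, h, d1]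
    · left; rw [← sdiff_sdiff_cancel_left hB, h, d2]
  · rintro (rfl | rfl)
    · right; exact d1
    · left; exact d2

/-- The dual of a series-parallel matroid is series-parallel, except that the dual of a coloop is a
loop. -/
theorem IsSeriesParallel.dual (h : IsSeriesParallel M) :
    IsSeriesParallel M✶ ∨ ∃ e, M✶ = loopyOn {e} := by
  induction h with
  | coloop e => exact Or.inr ⟨e, freeOn_dual_eq⟩
  | @parallel M N hM h ih =>
    rcases ih with ih | ⟨e, he⟩
    · exact Or.inl (ih.series (by rwa [IsSeriesExtension, dual_dual, dual_dual]))
    · left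
      have : M = freeOn {e} := by rw [← dual_inj, he, freeOn_dual_eq]
      rw [dual_eq_self_of_parallelExtension_coloop (this ▸ h)]
      exact hM.parallel h
  | @series M N hM h ih =>
    rcases ih with ih | ⟨e, he⟩
    · exact Or.inl (ih.parallel h)
    · rw [IsSeriesExtension, he] at h
      exact h.not_loopyOn.elim

/-- The components allowed in a direct sum: series-parallel matroids and loops. -/
def IsSeriesParallelOrLoop (N : Matroid α) : Prop :=
  IsSeriesParallel N ∨ ∃ e, N = Matroid.loopyOn {e}

theorem IsSeriesParallelOrLoop.dual (h : IsSeriesParallelOrLoop M) :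
    IsSeriesParallelOrLoop M✶ := by
  rcases h with h | ⟨e, rfl⟩
  · exact h.dual
  · exact Or.inl (IsSeriesParallel.coloop e)

theorem dual_disjointSigma {ι : Type*} {K : ι → Matroid α}
    (h : Pairwise (Function.onFun Disjoint fun i => (K i).E))
    (h' : Pairwise (Function.onFun Disjoint fun i => (K i)✶.E)) :
    (Matroid.disjointSigma K h)✶ = Matroid.disjointSigma (fun i => (K i)✶) h' := by
  refine ext_isBase (by simp) fun B hB => ?_
  rw [dual_ground, disjointSigma_ground_eq] at hB
  rw [dual_isBase_iff', disjointSigma_isBase_iff, disjointSigma_isBase_iff, disjointSigma_ground_eq]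
  have : ∀ i, ((⋃ i, (K i).E) \ B) ∩ (K i).E = (K i).E \ (B ∩ (K i).E) := by
    intro i
    ext x
    simp only [mem_inter_iff, mem_sdiff, mem_iUnion, not_and]
    grind
  simp only [this, dual_isBase_iff inter_subset_right, dual_ground, hB, and_true,
    and_iff_left_iff_imp]
  intro _
  exact sdiff_subset

theorem IsSeriesParallelLoopSum.dual (h : IsSeriesParallelLoopSum M) :
    IsSeriesParallelLoopSum M✶ := by
  obtain ⟨m, K, hK, hP, rfl⟩ := h
  exact ⟨m, fun i => (K i)✶, hK, fun i => IsSeriesParallelOrLoop.dual (hP i),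
    dual_disjointSigma hK _⟩

/-- A parallel extension of a direct sum extends one of the summands. -/
theorem IsSeriesParallelLoopSum.parallelExtension (h : IsSeriesParallelLoopSum M)
    (hN : IsParallelExtension M N) : IsSeriesParallelLoopSum N := by
  classical
  obtain ⟨m, K, hK, hP, rfl⟩ := h
  obtain ⟨e, he, f, hf, hE, hdel, hC⟩ := hN
  have hef : e ≠ f := fun h => hf (h ▸ he)
  obtain ⟨hNe, hNf⟩ := indep_singletons_of_circuit_pair hC hef
  simp only [disjointSigma_ground_eq, mem_iUnion, not_exists] at he hf
  rw [disjointSigma_ground_eq] at hE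
  obtain ⟨j, hj⟩ := he
  have hdisj : ∀ {i x}, i ≠ j → x ∈ (K i).E → x ∉ (K j).E := fun hij h1 h2 =>
    (hK hij).le_bot ⟨h1, h2⟩
  -- independence in `N` away from `f`
  have hind : ∀ I, f ∉ I → (N.Indep I ↔ (∀ i, (K i).Indep (I ∩ (K i).E)) ∧ I ⊆ ⋃ i, (K i).E) := by
    intro I hfI
    rw [← disjointSigma_indep_iff (h := hK), ← hdel, delete_indep_iff,
      and_iff_left (disjoint_singleton_right.2 hfI)]
  have hKj : (N ↾ insert f (K j).E).delete {f} = K j := by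
    refine ext_indep ?_ fun I hI => ?_
    · rw [delete_ground, restrict_ground_eq, insert_sdiff_self_of_notMem (hf j)]
    · rw [delete_ground, restrict_ground_eq, insert_sdiff_self_of_notMem (hf j)] at hI
      have hfI : f ∉ I := fun h => hf j (hI h)
      rw [delete_indep_iff, restrict_indep_iff, hind I hfI,
        and_iff_left (disjoint_singleton_right.2 hfI), and_iff_left (hI.trans (subset_insert _ _))]
      constructor
      · intro h
        have := h.1 j
        rwa [inter_eq_self_of_subset_left hI] at this
      · intro h
        refine ⟨fun i => ?_, hI.trans (subset_iUnion (fun i => (K i).E) j)⟩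
        by_cases hij : i = j
        · subst hij; rwa [inter_eq_self_of_subset_left hI]
        · have : I ∩ (K i).E = ∅ := by
            ext x
            simp only [mem_inter_iff, mem_empty_iff_false, iff_false, not_and]
            exact fun hx hxi => hdisj hij hxi (hI hx)
          rw [this]; exact (K i).empty_indep
  have hpar : IsParallelExtension (K j) (N ↾ insert f (K j).E) := by
    refine ⟨e, hj, f, hf j, rfl, hKj, ?_⟩
    rw [restrict_isCircuit_iff (by
      rw [hE]; exact insert_subset_insert (subset_iUnion (fun i => (K i).E) j))]
    exact ⟨hC, by rintro x (rfl | rfl); exacts [Or.inr hj, Or.inl rfl]⟩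
  let K' : Fin m → Matroid α := Function.update K j (N ↾ insert f (K j).E)
  have hK'j : K' j = N ↾ insert f (K j).E := by simp [K']
  have hK'ne : ∀ i, i ≠ j → K' i = K i := fun i hi => by simp [K', hi]
  have hK'E : ∀ i, (K' i).E = if i = j then insert f (K j).E else (K i).E := by
    intro i
    split_ifs with hi
    · rw [hi, hK'j, restrict_ground_eq]
    · rw [hK'ne i hi]
  have hK' : Pairwise (Function.onFun Disjoint fun i => (K' i).E) := by
    intro a b hab
    have h0 := hK hab
    simp only [Function.onFun, hK'E, Set.disjoint_left] at h0 ⊢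
    intro x
    have := hf a
    have := hf b
    split_ifs with h1 h2 h2
    · exact absurd (h1.trans h2.symm) hab
    · subst h1; rintro (rfl | hx)
      · assumption
      · exact fun h => hdisj h2 h hx
    · subst h2; rintro hx (rfl | h)
      · exact absurd hx ‹_›
      · exact hdisj h1 hx h
    · exact fun hx => h0 hx
  have hgr : ⋃ i, (K' i).E = insert f (⋃ i, (K i).E) := by
    ext x
    simp only [mem_iUnion, hK'E, mem_insert_iff]
    constructor
    · rintro ⟨i, hi⟩
      split_ifs at hi
      · rcases hi with rfl | hi
        · exact Or.inl rfl
        · exact Or.inr ⟨j, hi⟩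
      · exact Or.inr ⟨i, hi⟩
    · rintro (rfl | ⟨i, hi⟩)
      · exact ⟨j, by simp⟩
      · refine ⟨i, ?_⟩
        split_ifs with h
        · exact Or.inr (h ▸ hi)
        · exact hi
  refine ⟨m, K', hK', fun i => ?_, ?_⟩
  · by_cases hi : i = j
    · subst hi
      rw [hK'j]
      rcases hP i with h | ⟨x, hx⟩
      · exact Or.inl (h.parallel hpar)
      · rw [hx] at hpar; exact (hpar.not_loopyOn).elim
    · rw [hK'ne i hi]; exact hP i
  · -- independence of a set containing `f` is tested after exchanging `f` for `e`
    have hsub : ∀ I, I ⊆ insert f (⋃ i, (K i).E) →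
        (N.Indep I ↔ ∀ i, (K' i).Indep (I ∩ (K' i).E)) := by
      intro I hI
      have hI' : I \ {f} ⊆ ⋃ i, (K i).E := by
        rintro x ⟨hx, hxf⟩
        exact (hI hx).resolve_left hxf
      constructor
      · intro h i
        by_cases hi : i = j
        · subst hi
          rw [hK'j, restrict_indep_iff, restrict_ground_eq]
          exact ⟨h.subset inter_subset_left, inter_subset_right⟩
        · rw [hK'ne i hi]
          have h1 := ((hind (I \ {f}) (by simp)).1 (h.subset sdiff_subset)).1 i
          rwa [show (I \ {f}) ∩ (K i).E = I ∩ (K i).E by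
            ext x
            simp only [mem_inter_iff, mem_sdiff, mem_singleton_iff]
            have := hf i
            grind] at h1
      · intro h
        have hj' := h j
        rw [hK'j, restrict_indep_iff, restrict_ground_eq] at hj'
        by_cases hfI : f ∈ I
        · have heI : e ∉ I := fun heI => hC.not_indep (hj'.1.subset (by
            rintro x (rfl | rfl)
            · exact ⟨heI, Or.inr hj⟩
            · exact ⟨hfI, Or.inl rfl⟩))
          have e1 : insert f (I \ {f}) = I := insert_sdiff_self_of_mem hfI
          rw [← e1, indep_insert_iff_of_circuit_pair hC hef (by simp [heI]) (by simp),
            hind _ (by simp [hef.symm])]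
          refine ⟨fun i => ?_, insert_subset (mem_iUnion.2 ⟨j, hj⟩) hI'⟩
          by_cases hi : i = j
          · subst hi
            have h2 : N.Indep (insert f ((I \ {f}) ∩ (K i).E)) := by
              refine hj'.1.subset ?_
              rintro x (rfl | ⟨⟨hx, -⟩, hx'⟩)
              · exact ⟨hfI, Or.inl rfl⟩
              · exact ⟨hx, Or.inr hx'⟩
            rw [indep_insert_iff_of_circuit_pair hC hef (by simp [heI]) (by simp),
              hind _ (by simp [hef.symm])] at h2
            have h3 := h2.1 i
            rw [insert_inter_of_mem hj]
            rwa [insert_inter_of_mem hj, inter_assoc, inter_self] at h3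
          · have h2 := h i
            rw [hK'ne i hi] at h2
            rw [insert_inter_of_notMem (fun h => hdisj hi h hj)]
            exact h2.subset (inter_subset_inter_left _ sdiff_subset)
        · rw [hind I hfI]
          refine ⟨fun i => ?_, ?_⟩
          · by_cases hi : i = j
            · subst hi
              have h2 : N.Indep (I ∩ (K i).E) :=
                hj'.1.subset (inter_subset_inter_right _ (subset_insert _ _))
              have h3 := ((hind _ (fun h => hfI h.1)).1 h2).1 i
              rwa [inter_assoc, inter_self] at h3
            · have h2 := h i
              rwa [hK'ne i hi] at h2
          · rwa [sdiff_singleton_eq_self hfI] at hI'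
    refine ext_indep (by rw [disjointSigma_ground_eq, hgr, hE]) fun I hI => ?_
    rw [hE] at hI
    rw [hsub I hI, disjointSigma_indep_iff, hgr, and_iff_left hI]

theorem IsSeriesParallelLoopSum.seriesExtension (h : IsSeriesParallelLoopSum M)
    (hN : IsSeriesExtension M N) : IsSeriesParallelLoopSum N := by
  have := (h.dual.parallelExtension hN).dual
  rwa [dual_dual] at this

theorem isSeriesParallelLoopSum_emptyOn : IsSeriesParallelLoopSum (emptyOn α) := by
  have hK : Pairwise (Function.onFun Disjoint fun i : Fin 0 => (emptyOn α).E) := fun i => i.elim0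
  refine ⟨0, fun _ => emptyOn α, hK, fun i => i.elim0, ?_⟩
  refine ext_isBase (by rw [disjointSigma_ground_eq]; simp) fun B hB => ?_
  rw [emptyOn_ground, subset_empty_iff] at hB
  rw [disjointSigma_isBase_iff]
  simp [hB]

theorem IsSeriesParallelLoopSum.disjointSum {Q : Matroid α} (h : IsSeriesParallelLoopSum M)
    (hQ : IsSeriesParallelOrLoop Q) (hd : Disjoint M.E Q.E) :
    IsSeriesParallelLoopSum (M.disjointSum Q hd) := by
  obtain ⟨m, K, hK, hP, rfl⟩ := h
  rw [disjointSigma_ground_eq, disjoint_iUnion_left] at hd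
  have hK' : Pairwise (Function.onFun Disjoint fun i =>
      ((Fin.cons Q K : Fin (m + 1) → Matroid α) i).E) := by
    intro a b hab
    induction a using Fin.cases with
    | zero =>
      induction b using Fin.cases with
      | zero => exact absurd rfl hab
      | succ b => simpa [Function.onFun] using (hd b).symm
    | succ a =>
      induction b using Fin.cases with
      | zero => simpa [Function.onFun] using hd a
      | succ b => simpa [Function.onFun] using hK (fun h => hab (congrArg Fin.succ h))
  refine ⟨m + 1, Fin.cons Q K, hK', ?_, ?_⟩
  · intro i
    induction i using Fin.cases with
    | zero => exact hQ
    | succ i => exact hP i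
  · have hgr : ⋃ i, (Fin.cons (α := fun _ => Matroid α) Q K i).E = (⋃ i, (K i).E) ∪ Q.E := by
      ext x
      simp [Fin.exists_fin_succ, or_comm]
    refine ext_isBase ?_ fun B hB => ?_
    · rw [disjointSum_ground_eq, disjointSigma_ground_eq, disjointSigma_ground_eq, hgr]
    · rw [disjointSum_ground_eq, disjointSigma_ground_eq] at hB
      have key : ∀ i, B ∩ (⋃ i, (K i).E) ∩ (K i).E = B ∩ (K i).E := fun i => by
        rw [inter_assoc, inter_eq_self_of_subset_right (subset_iUnion (fun i => (K i).E) i)]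
      rw [disjointSum_isBase_iff, disjointSigma_isBase_iff, disjointSigma_isBase_iff,
        disjointSigma_ground_eq, hgr, Fin.forall_fin_succ]
      simp only [key, Fin.cons_zero, Fin.cons_succ, hB, and_true, inter_subset_right]
      exact and_comm

/-- Adding a loop. -/
theorem IsSeriesParallelLoopSum.exists_add_loop (h : IsSeriesParallelLoopSum M) (hf : f ∉ M.E) :
    ∃ N, N.E = insert f M.E ∧ IsSeriesParallelLoopSum N ∧
      ∀ B, N.IsBase B ↔ f ∉ B ∧ M.IsBase B := by
  have hd : Disjoint M.E (loopyOn {f}).E := by simpa using hf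
  refine ⟨M.disjointSum (loopyOn {f}) hd, by simp,
    h.disjointSum (Or.inr ⟨f, rfl⟩) hd, fun B => ?_⟩
  rw [disjointSum_isBase_iff, loopyOn_isBase_iff, loopyOn_ground]
  constructor
  · rintro ⟨h1, h2, h3⟩
    have hfB : f ∉ B := fun h => (h2.subset ⟨h, rfl⟩ : f ∈ (∅ : Set α))
    refine ⟨hfB, ?_⟩
    rwa [inter_eq_self_of_subset_left] at h1
    intro x hx
    exact (h3 hx).resolve_right fun h => hfB (h ▸ hx)
  · rintro ⟨h1, h2⟩
    exact ⟨by rwa [inter_eq_self_of_subset_left h2.subset_ground], by simpa using h1,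
      h2.subset_ground.trans subset_union_left⟩

/-- Adding a coloop. -/
theorem IsSeriesParallelLoopSum.exists_add_coloop (h : IsSeriesParallelLoopSum M) (hf : f ∉ M.E) :
    ∃ N, N.E = insert f M.E ∧ IsSeriesParallelLoopSum N ∧
      ∀ B, N.IsBase B ↔ f ∈ B ∧ M.IsBase (B \ {f}) := by
  have hd : Disjoint M.E (freeOn {f}).E := by simpa using hf
  refine ⟨M.disjointSum (freeOn {f}) hd, by simp,
    h.disjointSum (Or.inl (.coloop f)) hd, fun B => ?_⟩
  rw [disjointSum_isBase_iff, freeOn_isBase_iff, freeOn_ground]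
  constructor
  · rintro ⟨h1, h2, h3⟩
    refine ⟨(h2.symm.subset rfl).1, ?_⟩
    convert h1 using 1
    ext x
    simp only [mem_sdiff, mem_singleton_iff, mem_inter_iff, and_congr_right_iff]
    intro hx
    refine ⟨fun h => (h3 hx).resolve_right h, ?_⟩
    rintro h rfl
    exact hf h
  · rintro ⟨h1, h2⟩
    have h3 : B ∩ M.E = B \ {f} := by
      ext x
      simp only [mem_sdiff, mem_singleton_iff, mem_inter_iff, and_congr_right_iff]
      intro hx
      refine ⟨?_, fun h => h2.subset_ground ⟨hx, h⟩⟩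
      rintro h rfl
      exact hf h
    refine ⟨by rwa [h3], by simpa using h1, fun x hx => ?_⟩
    by_cases hxf : x = f
    · exact Or.inr hxf
    · exact Or.inl (h2.subset_ground ⟨hx, hxf⟩)

/-! ### Connectedness of series-parallel matroids -/

theorem dual_disjointSum {N₁ N₂ : Matroid α} (h : Disjoint N₁.E N₂.E)
    (h' : Disjoint N₁✶.E N₂✶.E) :
    (N₁.disjointSum N₂ h)✶ = N₁✶.disjointSum N₂✶ h' := by
  refine ext_isBase (by simp) fun B hB => ?_
  rw [dual_ground, disjointSum_ground_eq] at hB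
  rw [dual_isBase_iff', disjointSum_isBase_iff, disjointSum_isBase_iff, disjointSum_ground_eq]
  have h1 : ((N₁.E ∪ N₂.E) \ B) ∩ N₁.E = N₁.E \ (B ∩ N₁.E) := by
    ext x; simp only [mem_inter_iff, mem_sdiff, mem_union]; tauto
  have h2 : ((N₁.E ∪ N₂.E) \ B) ∩ N₂.E = N₂.E \ (B ∩ N₂.E) := by
    ext x; simp only [mem_inter_iff, mem_sdiff, mem_union]; tauto
  simp only [h1, h2, dual_isBase_iff inter_subset_right, dual_ground, hB, and_true, sdiff_subset]

theorem IsConnected.dual (h : IsConnected M) : IsConnected M✶ := by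
  rintro ⟨N₁, N₂, hd, h1, h2, hM⟩
  have hd' : Disjoint N₁✶.E N₂✶.E := hd
  refine h ⟨N₁✶, N₂✶, hd', h1, h2, ?_⟩
  rw [← dual_disjointSum hd hd', ← hM, dual_dual]

theorem IsConnected.parallelExtension (h : IsConnected M) (hN : IsParallelExtension M N) :
    IsConnected N := by
  obtain ⟨e, he, f, hf, hE, hdel, hC⟩ := hN
  have hef : e ≠ f := fun h => hf (h ▸ he)
  obtain ⟨hNe, hNf⟩ := indep_singletons_of_circuit_pair hC hef
  rintro ⟨N₁, N₂, hd, h1, h2, rfl⟩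
  rw [disjointSum_ground_eq] at hE
  -- both parallel elements lie in the same summand
  have key : ∀ (N₁ N₂ : Matroid α) (hd : Disjoint N₁.E N₂.E), N₂.E.Nonempty →
      N₁.E ∪ N₂.E = insert f M.E → (N₁.disjointSum N₂ hd).delete {f} = M →
      (N₁.disjointSum N₂ hd).IsCircuit {e, f} → f ∈ N₁.E → False := by
    intro N₁ N₂ hd h2 hE hdel hC hf₁
    obtain ⟨hNe, hNf⟩ := indep_singletons_of_circuit_pair hC hef
    have hf₂ : f ∉ N₂.E := fun h' => hd.le_bot ⟨hf₁, h'⟩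
    have he₁ : e ∈ N₁.E := by
      by_contra he₁
      have he₂ : e ∈ N₂.E := ((hE ▸ Or.inr he : e ∈ N₁.E ∪ N₂.E)).resolve_left he₁
      refine hC.not_indep ?_
      rw [disjointSum_indep_iff] at hNe hNf ⊢
      rw [show ({e, f} : Set α) ∩ N₁.E = {f} ∩ N₁.E by ext x; simp; grind,
        show ({e, f} : Set α) ∩ N₂.E = {e} ∩ N₂.E by ext x; simp; grind]
      exact ⟨hNf.1, hNe.2.1, by rintro x (rfl | rfl); exacts [Or.inr he₂, Or.inl hf₁]⟩
    have hd' : Disjoint (N₁.delete {f}).E N₂.E := hd.mono_left sdiff_subset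
    refine h ⟨N₁.delete {f}, N₂, hd', ⟨e, he₁, hef⟩, h2, ?_⟩
    rw [← hdel]
    refine ext_indep ?_ fun I hI => ?_
    · rw [delete_ground, disjointSum_ground_eq, disjointSum_ground_eq, delete_ground,
        union_sdiff_distrib, sdiff_singleton_eq_self hf₂]
    · have hfI : f ∉ I := fun h' => (hI h').2 rfl
      have hIE : I ⊆ N₁.E ∪ N₂.E := fun x hx => by
        have := (hI hx).1
        rwa [disjointSum_ground_eq] at this
      rw [delete_indep_iff, disjointSum_indep_iff, disjointSum_indep_iff, delete_indep_iff,
        delete_ground]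
      have e1 : I ∩ (N₁.E \ {f}) = I ∩ N₁.E := by
        ext x; simp only [mem_inter_iff, mem_sdiff, mem_singleton_iff]; grind
      have e2 : I ⊆ N₁.E \ {f} ∪ N₂.E := fun x hx => by
        rcases hIE hx with h' | h'
        · exact Or.inl ⟨h', fun h'' => hfI (h'' ▸ hx)⟩
        · exact Or.inr h'
      simp [e1, e2, hIE, hfI]
  have hfE : f ∈ N₁.E ∪ N₂.E := by rw [hE]; exact Or.inl rfl
  rcases hfE with hf₁ | hf₂
  · exact key N₁ N₂ hd h2 hE hdel hC hf₁
  · rw [disjointSum_comm] at hdel hC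
    exact key N₂ N₁ hd.symm h1 (by rw [union_comm, hE]) hdel hC hf₂

theorem IsSeriesParallel.isConnected (h : IsSeriesParallel M) : IsConnected M := by
  induction h with
  | coloop e =>
    rintro ⟨N₁, N₂, hd, ⟨x, hx⟩, ⟨y, hy⟩, hM⟩
    have hE := congrArg Matroid.E hM
    rw [freeOn_ground, disjointSum_ground_eq] at hE
    have h1 : x = e := hE.symm.subset (Or.inl hx)
    have h2 : y = e := hE.symm.subset (Or.inr hy)
    exact hd.le_bot ⟨hx, (h1.trans h2.symm) ▸ hy⟩
  | parallel _ h ih => exact ih.parallelExtension h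
  | series _ h ih =>
    have := (ih.dual.parallelExtension h).dual
    rwa [dual_dual] at this

end Extensions

/-! ### Matroids of narrow lattice paths -/

section PathMatroid

open Set Matroid

variable {α : Type*}

/-- The increments of the path that goes up exactly at the elements of `B`. -/
noncomputable def charZ (B : Set α) : α → ℤ := B.indicator fun _ => 1

theorem charZ_of_mem {B : Set α} {a : α} (h : a ∈ B) : charZ B a = 1 := indicator_of_mem h _

theorem charZ_of_notMem {B : Set α} {a : α} (h : a ∉ B) : charZ B a = 0 := indicator_of_notMem h _

theorem charZ_congr {B B' : Set α} {a : α} (h : a ∈ B ↔ a ∈ B') : charZ B a = charZ B' a := by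
  by_cases ha : a ∈ B
  · rw [charZ_of_mem ha, charZ_of_mem (h.1 ha)]
  · rw [charZ_of_notMem ha, charZ_of_notMem fun h' => ha (h.2 h')]

/-- The set `B` describes a path that respects the bounds of `L` and ends at height `r`. -/
def IsPath (L : List (Step α)) (r : ℤ) (B : Set α) : Prop :=
  Holds Step.Closed (charZ B) L ∧ height (charZ B) L = r

/-- The set of elements at which a path takes its steps. -/
def elts (L : List (Step α)) : Set α := {a | a ∈ L.map Step.elt}

@[simp] theorem elts_nil : elts ([] : List (Step α)) = ∅ := by ext; simp [elts]

@[simp] theorem elts_cons (p : Step α) (L : List (Step α)) :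
    elts (p :: L) = insert p.elt (elts L) := by
  ext; simp [elts]

theorem isPath_congr {L : List (Step α)} {r : ℤ} {B B' : Set α}
    (h : ∀ a ∈ elts L, (a ∈ B ↔ a ∈ B')) : IsPath L r B ↔ IsPath L r B' := by
  have h' : ∀ p ∈ L, charZ B p.elt = charZ B' p.elt := fun p hp =>
    charZ_congr (h _ (List.mem_map_of_mem hp))
  rw [IsPath, IsPath, holds_congr h', height_congr h']

theorem isPath_cons {p : Step α} {L : List (Step α)} {r : ℤ} {B : Set α} :
    IsPath (p :: L) r B ↔
      (p.elt ∉ B ∧ (p.lo ≤ r ∧ r ≤ p.hi ∧ p.bot ≤ 0 ∧ 0 ≤ p.top) ∧ IsPath L r B) ∨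
      (p.elt ∈ B ∧ (p.lo ≤ r - 1 ∧ r - 1 ≤ p.hi ∧ p.bot ≤ 1 ∧ 1 ≤ p.top) ∧ IsPath L (r - 1) B) := by
  simp only [IsPath, Holds, height_cons, Step.Closed, Int.cast_id]
  by_cases h : p.elt ∈ B
  · simp only [charZ_of_mem h, h, not_true, false_and, false_or, true_and]
    constructor
    · rintro ⟨⟨⟨⟨h1, h2⟩, h3, h4⟩, h5⟩, h6⟩
      exact ⟨⟨by omega, by omega, h3, h4⟩, h5, by omega⟩
    · rintro ⟨⟨h1, h2, h3, h4⟩, h5, h6⟩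
      exact ⟨⟨⟨⟨by omega, by omega⟩, h3, h4⟩, h5⟩, by omega⟩
  · simp only [charZ_of_notMem h, h, not_false_iff, false_and, or_false, true_and]
    constructor
    · rintro ⟨⟨⟨⟨h1, h2⟩, h3, h4⟩, h5⟩, h6⟩
      exact ⟨⟨by omega, by omega, h3, h4⟩, h5, by omega⟩
    · rintro ⟨⟨h1, h2, h3, h4⟩, h5, h6⟩
      exact ⟨⟨⟨⟨by omega, by omega⟩, h3, h4⟩, h5⟩, by omega⟩

/-- The paths for `L` ending at height `r` are the bases of a direct sum of series-parallel matroids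
and loops. -/
def HasPathMatroid (L : List (Step α)) (r : ℤ) : Prop :=
  ∃ N : Matroid α, N.E = elts L ∧ IsSeriesParallelLoopSum N ∧
    ∀ B ⊆ elts L, (N.IsBase B ↔ IsPath L r B)

/-- If there are paths for narrow bounds at all, then they are the bases of a direct sum of
series-parallel matroids and loops. -/
theorem hasPathMatroid_of_narrow (L : List (Step α)) (hL : (L.map Step.elt).Nodup)
    (hn : ∀ p ∈ L, p.Narrow) (r : ℤ) (hex : ∃ B, IsPath L r B) : HasPathMatroid L r := by
  induction hlen : L.length using Nat.strong_induction_on generalizing L r with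
  | _ n ih =>
  rcases L with _ | ⟨f, L⟩
  · obtain ⟨B, hB⟩ := hex
    have hr : (0 : ℤ) = r := hB.2
    refine ⟨emptyOn α, by simp, isSeriesParallelLoopSum_emptyOn, fun B hB => ?_⟩
    rw [elts_nil, subset_empty_iff] at hB
    simp [hB, IsPath, Holds, hr]
  obtain ⟨hfL, hL'⟩ : f.elt ∉ elts L ∧ (L.map Step.elt).Nodup := List.nodup_cons.1 hL
  obtain ⟨fn1, fn2, fn3⟩ := hn f List.mem_cons_self
  have hn' : ∀ p ∈ L, p.Narrow := fun p hp => hn p (List.mem_cons_of_mem _ hp)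
  have ihL : ∀ s, (∃ B, IsPath L s B) → HasPathMatroid L s := fun s hs =>
    ih L.length (by rw [← hlen]; simp) L hL' hn' s hs rfl
  have hsub : ∀ {B}, B ⊆ elts (f :: L) → f.elt ∉ B → B ⊆ elts L := by
    intro B hB hf x hx
    have := hB hx
    rw [elts_cons] at this
    exact this.resolve_left fun h => hf (h ▸ hx)
  have hsub' : ∀ {B}, B ⊆ elts (f :: L) → B \ {f.elt} ⊆ elts L := by
    rintro B hB x ⟨hx, hxf⟩
    have := hB hx
    rw [elts_cons] at this
    exact this.resolve_left hxf
  have hdel : ∀ s B, IsPath L s (B \ {f.elt}) ↔ IsPath L s B := fun s B =>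
    isPath_congr fun a ha => by
      simp only [mem_sdiff, mem_singleton_iff, and_iff_left_iff_imp]
      rintro - rfl
      exact hfL ha
  by_cases A0 : (f.lo ≤ r ∧ r ≤ f.hi ∧ f.bot ≤ 0 ∧ 0 ≤ f.top) ∧ ∃ B, IsPath L r B
  swap
  · -- every path goes up at the last step
    have key : ∀ B, IsPath (f :: L) r B ↔ f.elt ∈ B ∧
        (f.lo ≤ r - 1 ∧ r - 1 ≤ f.hi ∧ f.bot ≤ 1 ∧ 1 ≤ f.top) ∧ IsPath L (r - 1) B := by
      intro B
      rw [isPath_cons]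
      exact or_iff_right fun h => A0 ⟨h.2.1, B, h.2.2⟩
    obtain ⟨B₁, hB₁⟩ := hex
    obtain ⟨-, hc, hp⟩ := (key B₁).1 hB₁
    obtain ⟨N₁, hE, hN₁, hbase⟩ := ihL _ ⟨B₁, hp⟩
    obtain ⟨N, hNE, hN, hNbase⟩ := hN₁.exists_add_coloop (f := f.elt) (by rwa [hE])
    refine ⟨N, by rw [hNE, hE, elts_cons], hN, fun B hB => ?_⟩
    rw [hNbase, key, hbase _ (hsub' hB), hdel, and_iff_right hc]
  by_cases A1 : (f.lo ≤ r - 1 ∧ r - 1 ≤ f.hi ∧ f.bot ≤ 1 ∧ 1 ≤ f.top) ∧ ∃ B, IsPath L (r - 1) B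
  swap
  · -- no path goes up at the last step
    have key : ∀ B, IsPath (f :: L) r B ↔ f.elt ∉ B ∧
        (f.lo ≤ r ∧ r ≤ f.hi ∧ f.bot ≤ 0 ∧ 0 ≤ f.top) ∧ IsPath L r B := by
      intro B
      rw [isPath_cons]
      exact or_iff_left fun h => A1 ⟨h.2.1, B, h.2.2⟩
    obtain ⟨B₁, hB₁⟩ := hex
    obtain ⟨-, hc, hp⟩ := (key B₁).1 hB₁
    obtain ⟨N₁, hE, hN₁, hbase⟩ := ihL _ ⟨B₁, hp⟩
    obtain ⟨N, hNE, hN, hNbase⟩ := hN₁.exists_add_loop (f := f.elt) (by rwa [hE])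
    refine ⟨N, by rw [hNE, hE, elts_cons], hN, fun B hB => ?_⟩
    rw [hNbase, key, and_iff_right hc]
    exact and_congr_right fun hf => hbase _ (hsub hB hf)
  obtain ⟨c0, B₀, hB₀⟩ := A0
  obtain ⟨c1, B₁, hB₁⟩ := A1
  have keyf : ∀ B, IsPath (f :: L) r B ↔
      (f.elt ∉ B ∧ IsPath L r B) ∨ (f.elt ∈ B ∧ IsPath L (r - 1) B) := by
    intro B
    rw [isPath_cons]
    simp only [c0, c1, true_and, and_self]
  rcases L with _ | ⟨e, L⟩
  · have h1 : (0 : ℤ) = r := hB₀.2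
    have h2 : (0 : ℤ) = r - 1 := hB₁.2
    omega
  obtain ⟨heL, hL''⟩ : e.elt ∉ elts L ∧ (L.map Step.elt).Nodup := List.nodup_cons.1 hL'
  obtain ⟨en1, en2, en3⟩ := hn' e List.mem_cons_self
  have hfe : f.elt ≠ e.elt := fun h => hfL (by rw [h, elts_cons]; exact Or.inl rfl)
  have hfL'' : f.elt ∉ elts L := fun h => hfL (by rw [elts_cons]; exact Or.inr h)
  have hbt : e.bot ≤ e.top := by
    rcases isPath_cons.1 hB₀ with ⟨-, h, -⟩ | ⟨-, h, -⟩ <;> omega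
  by_cases hforced : e.bot = e.top
  · -- the step at `e` is forced and can be removed
    let f' : Step α := ⟨f.elt, e.lo, e.hi, f.bot, f.top⟩
    have hlen' : (f' :: L).length < n := by rw [← hlen]; simp
    have hnodup : ((f' :: L).map Step.elt).Nodup := List.nodup_cons.2 ⟨hfL'', hL''⟩
    have hnar : ∀ p ∈ f' :: L, p.Narrow := by
      intro p hp
      rcases List.mem_cons.1 hp with rfl | hp
      · exact ⟨en1, fn2, fn3⟩
      · exact hn' p (List.mem_cons_of_mem _ hp)
    have hef' : e.elt ∉ elts (f' :: L) := by
      rw [elts_cons]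
      rintro (h | h)
      · exact hfe h.symm
      · exact heL h
    have hE' : elts (f :: e :: L) = insert e.elt (elts (f' :: L)) := by
      simp only [elts_cons, f']; exact insert_comm _ _ _
    have hv : e.bot = 0 ∨ e.bot = 1 := by omega
    rcases hv with hv | hv
    · have key : ∀ B, IsPath (f :: e :: L) r B ↔ e.elt ∉ B ∧ IsPath (f' :: L) r B := by
        intro B
        rw [keyf, isPath_cons, isPath_cons, isPath_cons, ← hforced, hv]
        by_cases hfB : f.elt ∈ B <;> by_cases heB : e.elt ∈ B <;> simp [f', hfB, heB, c0, c1]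
      obtain ⟨N₁, hE, hN₁, hbase⟩ := ih _ hlen' (f' :: L) hnodup hnar r
        (hex.imp fun B hB => ((key B).1 hB).2) rfl
      obtain ⟨N, hNE, hN, hNbase⟩ := hN₁.exists_add_loop (f := e.elt) (by rwa [hE])
      refine ⟨N, by rw [hNE, hE, hE'], hN, fun B hB => ?_⟩
      rw [hNbase, key]
      refine and_congr_right fun he => hbase _ fun x hx => ?_
      have := hB hx
      rw [hE'] at this
      exact this.resolve_left fun h => he (h ▸ hx)
    · have key : ∀ B, IsPath (f :: e :: L) r B ↔ e.elt ∈ B ∧ IsPath (f' :: L) (r - 1) B := by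
        intro B
        rw [keyf, isPath_cons, isPath_cons, isPath_cons, ← hforced, hv]
        by_cases hfB : f.elt ∈ B <;> by_cases heB : e.elt ∈ B <;> simp [f', hfB, heB, c0, c1]
      have hdel' : ∀ s B, IsPath (f' :: L) s (B \ {e.elt}) ↔ IsPath (f' :: L) s B := fun s B =>
        isPath_congr fun a ha => by
          simp only [mem_sdiff, mem_singleton_iff, and_iff_left_iff_imp]
          rintro - rfl
          exact hef' ha
      obtain ⟨N₁, hE, hN₁, hbase⟩ := ih _ hlen' (f' :: L) hnodup hnar (r - 1)
        (hex.imp fun B hB => ((key B).1 hB).2) rfl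
      obtain ⟨N, hNE, hN, hNbase⟩ := hN₁.exists_add_coloop (f := e.elt) (by rwa [hE])
      refine ⟨N, by rw [hNE, hE, hE'], hN, fun B hB => ?_⟩
      rw [hNbase, key]
      refine and_congr_right fun he => ?_
      rw [hbase, hdel']
      rintro x ⟨hx, hxe⟩
      have := hB hx
      rw [hE'] at this
      exact this.resolve_left hxe
  -- both increments are possible at `e`
  have hb0 : e.bot = 0 := by omega
  have ht1 : e.top = 1 := by omega
  have keye : ∀ s B, IsPath (e :: L) s B ↔
      (e.elt ∉ B ∧ (e.lo ≤ s ∧ s ≤ e.hi) ∧ IsPath L s B) ∨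
      (e.elt ∈ B ∧ (e.lo ≤ s - 1 ∧ s - 1 ≤ e.hi) ∧ IsPath L (s - 1) B) := by
    intro s B
    rw [isPath_cons, hb0, ht1]
    simp
  have hdele : ∀ s B, IsPath L s (B \ {e.elt}) ↔ IsPath L s B := fun s B =>
    isPath_congr fun a ha => by
      simp only [mem_sdiff, mem_singleton_iff, and_iff_left_iff_imp]
      rintro - rfl
      exact heL ha
  have hinse : ∀ s B, IsPath L s (insert e.elt B) ↔ IsPath L s B := fun s B =>
    isPath_congr fun a ha => by
      simp only [mem_insert_iff, or_iff_right_iff_imp]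
      rintro rfl
      exact absurd ha heL
  have hdelf : ∀ s B, IsPath L s (B \ {f.elt}) ↔ IsPath L s B := fun s B =>
    isPath_congr fun a ha => by
      simp only [mem_sdiff, mem_singleton_iff, and_iff_left_iff_imp]
      rintro - rfl
      exact hfL'' ha
  have heE : e.elt ∈ elts (e :: L) := by rw [elts_cons]; exact Or.inl rfl
  have hinter : ∀ s B, IsPath (e :: L) s (B ∩ elts (e :: L)) ↔ IsPath (e :: L) s B := fun s B =>
    isPath_congr fun a ha => and_iff_left ha
  by_cases hlo : e.lo ≤ r - 2
  · -- the height `r` is impossible before the step at `e`, and the last two steps are in series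
    obtain ⟨N₁, hE, hN₁, hbase⟩ := ihL (r - 1) ⟨B₁, hB₁⟩
    have hco : N₁✶.Indep {e.elt} := by
      have h1 : IsPath (e :: L) (r - 1) (B₀ \ {e.elt}) := by
        rw [keye, hdele]
        rcases (keye _ _).1 hB₀ with ⟨h1, h2, h3⟩ | ⟨h1, h2, h3⟩
        · omega
        · exact Or.inl ⟨by simp, h2, h3⟩
      have h2 := (hbase ((B₀ \ {e.elt}) ∩ elts (e :: L)) inter_subset_right).2
        ((hinter _ _).2 h1)
      refine h2.compl_isBase_dual.indep.subset ?_
      rw [singleton_subset_iff, hE]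
      exact ⟨heE, fun h => h.1.2 rfl⟩
    obtain ⟨N, hser, hNE, hNbase⟩ := exists_seriesExtension hco (f := f.elt) (by rwa [hE])
    refine ⟨N, by rw [hNE, hE, elts_cons f], hN₁.seriesExtension hser, fun B hB => ?_⟩
    rw [hNbase B (by rwa [hE, ← elts_cons f]), keyf, hbase _ (hsub' hB), hdel]
    by_cases hfB : f.elt ∈ B
    · simp [hfB]
    · rw [hbase _ (sdiff_subset.trans (hsub hB hfB)), keye (r - 1) (B \ {e.elt}), keye r B,
        hdele, hdele]
      have h1 : ¬ r ≤ e.hi := by omega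
      simp [hfB, h1]
  · -- the height `r - 2` is impossible before the step at `e`, and the last two steps are parallel
    obtain ⟨N₀, hE, hN₀, hbase⟩ := ihL r ⟨B₀, hB₀⟩
    have hlo' : ¬ e.lo ≤ r - 1 - 1 := by omega
    have hind : N₀.Indep {e.elt} := by
      have h1 : IsPath (e :: L) r (insert e.elt B₁) := by
        rw [keye, hinse, hinse]
        rcases (keye _ _).1 hB₁ with ⟨h1, h2, h3⟩ | ⟨h1, h2, h3⟩
        · exact Or.inr ⟨mem_insert _ _, h2, h3⟩
        · omega
      have h2 := (hbase (insert e.elt B₁ ∩ elts (e :: L)) inter_subset_right).2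
        ((hinter _ _).2 h1)
      refine h2.indep.subset ?_
      rw [singleton_subset_iff]
      exact ⟨mem_insert _ _, heE⟩
    obtain ⟨N, hpar, hNE, hNbase⟩ := exists_parallelExtension hind (f := f.elt) (by rwa [hE])
    refine ⟨N, by rw [hNE, hE, elts_cons f], hN₀.parallelExtension hpar, fun B hB => ?_⟩
    rw [hNbase, keyf]
    by_cases hfB : f.elt ∈ B
    · rw [hbase _ (insert_subset heE (hsub' hB)), keye r (insert e.elt (B \ {f.elt})),
        keye (r - 1) B, hinse, hinse, hdelf, hdelf]
      simp [hfB, hlo']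
    · rw [hbase _ (hsub hB hfB)]
      simp [hfB]

end PathMatroid

section Polytopes

open Set

variable {α : Type*} {E : Set α}

/-- The `0/1` point of a set `B`. -/
noncomputable def charPt (E : Set α) (B : Set α) : E → ℝ :=
  fun i : E => B.indicator (fun _ => (1 : ℝ)) (i : α)

theorem charPt_eq (B : Set α) (i : E) : charPt E B i = (charZ B i : ℤ) := by
  by_cases h : (i : α) ∈ B <;> simp [charPt, charZ, h]

/-- Forgetting that the elements of the steps lie in `E`. -/
def Step.coe (p : Step E) : Step α := ⟨p.elt, p.lo, p.hi, p.bot, p.top⟩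

theorem height_charPt (B : Set α) (L : List (Step E)) :
    height (charPt E B) L = ((height (charZ B) (L.map Step.coe) : ℤ) : ℝ) := by
  induction L with
  | nil => simp
  | cons p L ih => rw [height_cons, List.map_cons, height_cons, ih, charPt_eq]; simp [Step.coe]

theorem charPt_mem_pathPolytope (B : Set α) (L : List (Step E)) (r : ℤ) :
    charPt E B ∈ pathPolytope L r ↔ IsPath (L.map Step.coe) r B := by
  have h1 : Holds Step.Closed (charPt E B) L ↔ Holds Step.Closed (charZ B) (L.map Step.coe) := by
    induction L with
    | nil => rfl
    | cons p L ih =>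
      simp only [Holds, List.map_cons, ih, Step.Closed, height_charPt, charPt_eq, Int.cast_le,
        Int.cast_id]
      rfl
  show Holds Step.Closed (charPt E B) L ∧ height (charPt E B) L = r ↔ _ ∧ _
  rw [height_charPt, h1]
  norm_cast

theorem exists_charPt_eq {x : E → ℝ} (hx : ∀ i, x i = 0 ∨ x i = 1) :
    ∃ B ⊆ E, x = charPt E B := by
  refine ⟨{a | ∃ h : a ∈ E, x ⟨a, h⟩ = 1}, fun a ha => ha.1, ?_⟩
  funext i
  have := hx i
  by_cases h : x i = 1
  · simp [charPt, h]
  · simp [charPt, this.resolve_right h]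

theorem charPt_zero_or_one (B : Set α) (i : E) : charPt E B i = 0 ∨ charPt E B i = 1 := by
  by_cases h : (i : α) ∈ B <;> simp [charPt, h]

theorem basePolytope_eq_of_isBase_iff {N : MatroidOn E} {K : Set (E → ℝ)}
    (hK : K = convexHull ℝ {x ∈ K | ∀ i, x i = 0 ∨ x i = 1})
    (h : ∀ B ⊆ E, N.1.IsBase B ↔ charPt E B ∈ K) : basePolytope N = K := by
  rw [hK, basePolytope]
  congr 1
  ext x
  constructor
  · rintro ⟨B, hB, rfl⟩
    exact ⟨(h B (hB.subset_ground.trans N.2.subset)).1 hB, charPt_zero_or_one B⟩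
  · rintro ⟨hx, h01⟩
    obtain ⟨B, hBE, rfl⟩ := exists_charPt_eq h01
    exact ⟨B, (h B hBE).2 hx, rfl⟩

/-- A nonempty path polytope with narrow bounds is the base polytope of a direct sum of
series-parallel matroids and loops. -/
theorem exists_basePolytope_eq_pathPolytope [Finite E] {L : List (Step E)} {r : ℤ}
    (hL : (L.map Step.elt).Nodup) (hmem : ∀ i, i ∈ L.map Step.elt) (hn : ∀ p ∈ L, p.Narrow)
    (hne : (pathPolytope L r).Nonempty) :
    ∃ N : MatroidOn E, IsSeriesParallelLoopSum N.1 ∧ basePolytope N = pathPolytope L r := by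
  have hK := pathPolytope_eq_convexHull r hL (fun i => by simpa using hmem i)
    fun p hp => (hn p hp).2
  have hmap : (L.map Step.coe).map Step.elt = (L.map Step.elt).map Subtype.val := by
    rw [List.map_map, List.map_map]; rfl
  have helts : elts (L.map Step.coe) = E := by
    ext a
    rw [elts, mem_ofPred_eq, hmap, List.mem_map]
    constructor
    · rintro ⟨i, -, rfl⟩; exact i.2
    · exact fun ha => ⟨⟨a, ha⟩, hmem _, rfl⟩
  have hex : ∃ B, IsPath (L.map Step.coe) r B := by
    rw [hK, convexHull_nonempty_iff] at hne
    obtain ⟨x, hx, h01⟩ := hne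
    obtain ⟨B, -, rfl⟩ := exists_charPt_eq h01
    exact ⟨B, (charPt_mem_pathPolytope B L r).1 hx⟩
  obtain ⟨N, hNE, hN, hbase⟩ := hasPathMatroid_of_narrow (L.map Step.coe)
    (by rw [hmap]; exact hL.map Subtype.val_injective)
    (by
      intro p hp
      obtain ⟨q, hq, rfl⟩ := List.mem_map.1 hp
      exact hn q hq) r hex
  rw [helts] at hNE hbase
  refine ⟨⟨N, hNE⟩, hN, basePolytope_eq_of_isBase_iff hK fun B hB => ?_⟩
  rw [charPt_mem_pathPolytope]
  exact hbase B hB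

end Polytopes

/-! ### The base polytope by inequalities -/

section Edmonds

open Set Matroid

variable {α : Type*} {E : Set α}

/-- The rank function of `M` on finite subsets of its ground set. -/
noncomputable def rankFn (M : MatroidOn E) (X : Finset E) : ℤ :=
  ((M.1.eRk (Subtype.val '' (X : Set E))).toNat : ℤ)

theorem rankFn_nonneg (M : MatroidOn E) (X : Finset E) : 0 ≤ rankFn M X := Int.natCast_nonneg _

theorem polytopeIndicator_eq_indZ (M : MatroidOn E) :
    polytopeIndicator M = indZ (basePolytope M) := rfl

theorem interiorIndicator_eq_indZ (M : MatroidOn E) :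
    interiorIndicator M = indZ (intrinsicInterior ℝ (basePolytope M)) := rfl

theorem sum_charPt (B : Set α) (X : Finset E) :
    ∑ i ∈ X, charPt E B i = ((Subtype.val '' (X : Set E) ∩ B).ncard : ℝ) := by
  classical
  have h : Subtype.val '' (X : Set E) ∩ B =
      (((X.filter fun i : E => (i : α) ∈ B).map (Function.Embedding.subtype _) : Finset α) :
        Set α) := by
    ext a; simp
  rw [h, ncard_coe_finset, Finset.card_map, Finset.card_filter]
  push_cast
  exact Finset.sum_congr rfl fun i _ => by simp [charPt, indicator_apply]

theorem rankFn_coe [Finite E] (M : MatroidOn E) (X : Finset E) :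
    ((rankFn M X).toNat : ℕ∞) = M.1.eRk (Subtype.val '' (X : Set E)) := by
  rw [rankFn, Int.toNat_natCast, ENat.natCast_toNat]
  exact ((M.1.eRk_le_encard _).trans_lt ((X.finite_toSet.image _).encard_lt_top)).ne

theorem rankFn_submodular [Finite E] [DecidableEq E] (M : MatroidOn E) (X Y : Finset E) :
    rankFn M (X ∩ Y) + rankFn M (X ∪ Y) ≤ rankFn M X + rankFn M Y := by
  have h := M.1.eRk_inter_add_eRk_union_le (Subtype.val '' (X : Set E)) (Subtype.val '' (Y : Set E))
  rw [← image_inter Subtype.val_injective, ← image_union, ← Finset.coe_inter, ← Finset.coe_union,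
    ← rankFn_coe, ← rankFn_coe, ← rankFn_coe, ← rankFn_coe] at h
  have h1 : (rankFn M (X ∩ Y)).toNat + (rankFn M (X ∪ Y)).toNat ≤
    (rankFn M X).toNat + (rankFn M Y).toNat := by exact_mod_cast h
  have := rankFn_nonneg M X
  have := rankFn_nonneg M Y
  have := rankFn_nonneg M (X ∩ Y)
  have := rankFn_nonneg M (X ∪ Y)
  omega

theorem isBase_iff_charPt_mem [Fintype E] (M : MatroidOn E) {B : Set α} (hB : B ⊆ E) :
    M.1.IsBase B ↔ charPt E B ∈ rankPolytope (rankFn M) := by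
  classical
  have hfinE : E.Finite := toFinite E
  have hBfin : B.Finite := hfinE.subset hB
  have huniv : Subtype.val '' ((Finset.univ : Finset E) : Set E) = E := by simp
  have hle : ∀ X : Finset E, (∑ i ∈ X, charPt E B i ≤ rankFn M X) ↔
      (Subtype.val '' (X : Set E) ∩ B).encard ≤ M.1.eRk (Subtype.val '' (X : Set E)) := by
    intro X
    rw [sum_charPt, ← rankFn_coe, ← (hBfin.inter_of_right _).cast_ncard_eq]
    have := rankFn_nonneg M X
    rw [Nat.cast_le, ← Int.toNat_of_nonneg this]
    norm_cast
  have heq : (∑ i, charPt E B i = rankFn M Finset.univ) ↔ B.encard = M.1.eRank := by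
    have h1 : M.1.eRk (Subtype.val '' ((Finset.univ : Finset E) : Set E)) = M.1.eRank := by
      rw [huniv, eRank_def, M.2]
    rw [sum_charPt, ← h1, ← rankFn_coe, huniv, inter_eq_self_of_subset_right hB,
      ← hBfin.cast_ncard_eq]
    have := rankFn_nonneg M Finset.univ
    rw [Nat.cast_inj, ← Int.toNat_of_nonneg this]
    norm_cast
  constructor
  · intro h
    refine ⟨⟨⟨fun i => ?_, fun i => ?_⟩, heq.2 h.encard_eq_eRank⟩, fun X => (hle X).2 ?_⟩
    · rcases charPt_zero_or_one B i with h | h <;> simp [h]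
    · rcases charPt_zero_or_one B i with h | h <;> simp [h]
    · exact (h.indep.subset inter_subset_right).encard_le_eRk_of_subset inter_subset_left
  · rintro ⟨⟨-, hs⟩, hX⟩
    let X : Finset E := Finset.univ.filter fun i : E => (i : α) ∈ B
    have hXB : Subtype.val '' (X : Set E) = B := by
      ext a
      simp only [X, Finset.coe_filter, Finset.mem_univ, true_and, mem_image, mem_ofPred_eq]
      exact ⟨by rintro ⟨i, hi, rfl⟩; exact hi, fun ha => ⟨⟨a, hB ha⟩, ha, rfl⟩⟩
    have h1 := (hle X).1 (hX X)
    rw [hXB, inter_self] at h1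
    have hind : M.1.Indep B := (indep_iff_eRk_eq_encard_of_finite hBfin).2
      (le_antisymm (M.1.eRk_le_encard B) h1)
    exact hind.isBase_of_eRk_ge hBfin (by rw [hind.eRk_eq_encard, heq.1 hs])

/-- Edmonds' description of the base polytope. -/
theorem basePolytope_eq_rankPolytope [Fintype E] (M : MatroidOn E) :
    basePolytope M = rankPolytope (rankFn M) := by
  classical
  exact basePolytope_eq_of_isBase_iff
    (rankPolytope_eq_convexHull _ fun X Y => rankFn_submodular M X Y)
    fun B hB => isBase_iff_charPt_mem M hB

/-- Base polytopes decompose into narrow path polytopes. -/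
theorem polytopeIndicator_mem [Finite E] (M : MatroidOn E) (G : AddSubgroup ((E → ℝ) → ℤ))
    (hG : ∀ (L : List (Step E)) (r : ℤ), (L.map Step.elt).Nodup → (∀ i, i ∈ L.map Step.elt) →
      (∀ p ∈ L, p.Narrow) → indZ (pathPolytope L r) ∈ G) : polytopeIndicator M ∈ G := by
  classical
  have := Fintype.ofFinite E
  rw [polytopeIndicator_eq_indZ, basePolytope_eq_rankPolytope]
  exact indZ_rankPolytope_mem _ (fun X Y => rankFn_submodular M X Y) G fun L => hG L _

end Edmonds

/-! ### Relative interiors and faces of polyhedra -/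

section RelativeInterior

open Filter Topology

/-- The set of solutions of a system of linear inequalities `k.1 x ≤ k.2`. -/
def polyhedron {V : Type*} [AddCommGroup V] [Module ℝ V] (S : Set ((V →ₗ[ℝ] ℝ) × ℝ)) : Set V :=
  {x | ∀ k ∈ S, k.1 x ≤ k.2}

variable {ι : Type*}

theorem mem_intrinsicInterior_iff_nhdsWithin {K : Set (ι → ℝ)} {x : ι → ℝ} (hx : x ∈ K) :
    x ∈ intrinsicInterior ℝ K ↔ K ∈ 𝓝[(affineSpan ℝ K : Set (ι → ℝ))] x := by
  rw [mem_intrinsicInterior]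
  constructor
  · rintro ⟨y, hy, rfl⟩
    rw [mem_interior_iff_mem_nhds] at hy
    exact preimage_coe_mem_nhds_subtype.1 hy
  · intro h
    refine ⟨⟨x, subset_affineSpan ℝ K hx⟩, ?_, rfl⟩
    rw [mem_interior_iff_mem_nhds]
    exact preimage_coe_mem_nhds_subtype.2 h

/-- The relative interior of a polyhedron consists of the points at which only the implicit
equalities are tight. -/
theorem mem_intrinsicInterior_polyhedron [Finite ι] {S : Set (((ι → ℝ) →ₗ[ℝ] ℝ) × ℝ)}
    (hS : S.Finite) {x : ι → ℝ} (hx : x ∈ polyhedron S) :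
    x ∈ intrinsicInterior ℝ (polyhedron S) ↔
      ∀ k ∈ S, k.1 x = k.2 → ∀ z ∈ polyhedron S, k.1 z = k.2 := by
  rw [mem_intrinsicInterior_iff_nhdsWithin hx]
  constructor
  · intro h k hk hkx z hz
    by_contra hne
    have hlt : k.1 z < k.2 := lt_of_le_of_ne (hz k hk) hne
    -- move slightly beyond `x` on the ray from `z` through `x`
    have hcont : Tendsto (fun ε : ℝ => x + ε • (x - z)) (𝓝 0) (𝓝 x) := by
      have : Continuous fun ε : ℝ => x + ε • (x - z) := by fun_prop
      simpa using this.tendsto 0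
    have hspan : ∀ ε : ℝ, x + ε • (x - z) ∈ (affineSpan ℝ (polyhedron S) : Set (ι → ℝ)) := by
      intro ε
      have := AffineSubspace.smul_vsub_vadd_mem (affineSpan ℝ (polyhedron S)) ε
        (subset_affineSpan ℝ _ hx) (subset_affineSpan ℝ _ hz) (subset_affineSpan ℝ _ hx)
      rw [vsub_eq_sub, vadd_eq_add, add_comm] at this
      exact this
    have hev : ∀ᶠ ε in 𝓝 (0 : ℝ), x + ε • (x - z) ∈ polyhedron S :=
      (tendsto_nhdsWithin_iff.2 ⟨hcont, Eventually.of_forall hspan⟩).eventually h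
    obtain ⟨ε, h1, hε⟩ :=
      ((hev.filter_mono (nhdsWithin_le_nhds (s := Set.Ioi 0))).and self_mem_nhdsWithin).exists
    have hε' : (0 : ℝ) < ε := hε
    have h2 := h1 k hk
    rw [map_add, map_smul, map_sub, hkx, smul_eq_mul] at h2
    have : 0 < ε * (k.2 - k.1 z) := mul_pos hε' (by linarith)
    linarith
  · intro h
    have hspan : ∀ k ∈ S, k.1 x = k.2 →
        ∀ y ∈ (affineSpan ℝ (polyhedron S) : Set (ι → ℝ)), k.1 y = k.2 := by
      intro k hk hkx y hy
      refine affineSpan_induction (p := fun y => k.1 y = k.2) hy (h k hk hkx) ?_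
      intro c u v w hu hv hw
      rw [vsub_eq_sub, vadd_eq_add, map_add, map_smul, map_sub, hu, hv, hw]; simp
    have hev : ∀ᶠ y in 𝓝[(affineSpan ℝ (polyhedron S) : Set (ι → ℝ))] x, ∀ k ∈ S, k.1 y ≤ k.2 := by
      rw [Filter.eventually_all_finite hS]
      intro k hk
      rcases (hx k hk).eq_or_lt with hkx | hkx
      · filter_upwards [self_mem_nhdsWithin] with y hy using (hspan k hk hkx y hy).le
      · have hc : Continuous k.1 := k.1.continuous_of_finiteDimensional
        exact (((hc.tendsto x).eventually_lt_const hkx).filter_mono nhdsWithin_le_nhds).mono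
          fun y hy => hy.le
    exact hev

/-- The boundary of a polyhedron is the disjoint union of the relative interiors of its proper
faces. -/
theorem indZ_sub_interior_mem [Finite ι] (S : Finset (((ι → ℝ) →ₗ[ℝ] ℝ) × ℝ))
    (G : AddSubgroup ((ι → ℝ) → ℤ))
    (hG : ∀ J ⊆ S, (polyhedron (S : Set _) ∩ {x | ∀ k ∈ J, k.1 x = k.2}).Nonempty →
      polyhedron (S : Set _) ∩ {x | ∀ k ∈ J, k.1 x = k.2} ≠ polyhedron (S : Set _) →
      indZ (intrinsicInterior ℝ (polyhedron (S : Set _) ∩ {x | ∀ k ∈ J, k.1 x = k.2})) ∈ G) :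
    indZ (polyhedron (S : Set _)) - indZ (intrinsicInterior ℝ (polyhedron (S : Set _))) ∈ G := by
  classical
  let P : Set (ι → ℝ) := polyhedron (S : Set _)
  let tight : (ι → ℝ) → Finset (((ι → ℝ) →ₗ[ℝ] ℝ) × ℝ) := fun x => S.filter fun k => k.1 x = k.2
  have hPint : ∀ x ∈ P, (x ∈ intrinsicInterior ℝ P ↔ ∀ k ∈ tight x, ∀ z ∈ P, k.1 z = k.2) := by
    intro x hx
    rw [mem_intrinsicInterior_polyhedron S.finite_toSet hx]
    simp only [tight, Finset.mem_filter, Finset.mem_coe, and_imp]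
    rfl
  have hsum : indZ P - indZ (intrinsicInterior ℝ P) =
      ∑ J ∈ S.powerset, indZ {x | (x ∈ P ∧ x ∉ intrinsicInterior ℝ P) ∧ tight x = J} := by
    funext x
    rw [Finset.sum_apply, Finset.sum_eq_single (tight x)]
    · have hsub := intrinsicInterior_subset (𝕜 := ℝ) (s := P)
      by_cases h1 : x ∈ P <;> by_cases h2 : x ∈ intrinsicInterior ℝ P
      · simp [indZ, h1, h2, -mem_intrinsicInterior]
      · simp [indZ, h1, h2, -mem_intrinsicInterior]
      · exact absurd (hsub h2) h1
      · simp [indZ, h1, h2, -mem_intrinsicInterior]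
    · intro J _ hJ
      exact indZ_of_notMem fun h => hJ h.2.symm
    · intro h
      exact absurd (Finset.mem_powerset.2 (Finset.filter_subset _ _)) h
  show indZ P - indZ (intrinsicInterior ℝ P) ∈ G
  rw [hsum]
  refine sum_mem fun J hJ => ?_
  rw [Finset.mem_powerset] at hJ
  rcases Set.eq_empty_or_nonempty {x | (x ∈ P ∧ x ∉ intrinsicInterior ℝ P) ∧ tight x = J} with
    he | ⟨x₀, ⟨hx₀, hx₀'⟩, hJx₀⟩
  · rw [he, indZ_empty]; exact zero_mem _
  have htight : ∀ {x k}, k ∈ tight x ↔ k ∈ S ∧ k.1 x = k.2 := by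
    intro x k; simp [tight]
  let F : Set (ι → ℝ) := P ∩ {x | ∀ k ∈ J, k.1 x = k.2}
  have hx₀F : x₀ ∈ F := ⟨hx₀, fun k hk => (htight.1 (hJx₀ ▸ hk)).2⟩
  -- the face is the polyhedron given by the additional inequalities `-k.1 x ≤ -k.2`
  let S' : Set (((ι → ℝ) →ₗ[ℝ] ℝ) × ℝ) := (S : Set _) ∪ 
    (fun k : ((ι → ℝ) →ₗ[ℝ] ℝ) × ℝ => (-k.1, -k.2)) '' (J : Set (((ι → ℝ) →ₗ[ℝ] ℝ) × ℝ))
  have hS' : S'.Finite := S.finite_toSet.union (J.finite_toSet.image _)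
  have hF : F = polyhedron S' := by
    ext x
    constructor
    · rintro ⟨h1, h2⟩ k (hk | ⟨k, hk, rfl⟩)
      · exact h1 k hk
      · simp [h2 k hk]
    · intro h
      refine ⟨fun k hk => h k (Or.inl hk), fun k hk => le_antisymm (h k (Or.inl (hJ hk))) ?_⟩
      have := h _ (Or.inr ⟨k, hk, rfl⟩)
      simpa using this
  have hFint : ∀ x ∈ F, (x ∈ intrinsicInterior ℝ F ↔ tight x = J) := by
    intro x hx
    have hJx : J ⊆ tight x := fun k hk => htight.2 ⟨hJ hk, hx.2 k hk⟩
    rw [hF, mem_intrinsicInterior_polyhedron hS' (hF ▸ hx), ← hF]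
    constructor
    · intro h
      refine Finset.Subset.antisymm (fun k hk => ?_) hJx
      rw [← hJx₀]
      obtain ⟨h1, h2⟩ := htight.1 hk
      exact htight.2 ⟨h1, h k (Or.inl h1) h2 x₀ hx₀F⟩
    · rintro h k (hk | ⟨k, hk, rfl⟩) hkx z hz
      · exact hz.2 k (h ▸ htight.2 ⟨hk, hkx⟩)
      · simp [hz.2 k hk]
  have hset : {x | (x ∈ P ∧ x ∉ intrinsicInterior ℝ P) ∧ tight x = J} = intrinsicInterior ℝ F := by
    ext x
    constructor
    · rintro ⟨⟨h1, -⟩, h2⟩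
      exact (hFint x ⟨h1, fun k hk => (htight.1 (h2 ▸ hk)).2⟩).2 h2
    · intro h
      have hxF := intrinsicInterior_subset h
      have h2 := (hFint x hxF).1 h
      refine ⟨⟨hxF.1, fun h' => hx₀' ?_⟩, h2⟩
      rw [hPint x hxF.1, h2] at h'
      rwa [hPint x₀ hx₀, hJx₀]
  rw [hset]
  refine hG J hJ ⟨x₀, hx₀F⟩ fun hFP => hx₀' ?_
  rw [hPint x₀ hx₀, hJx₀]
  exact fun k hk z hz => (hFP.symm.subset hz).2 k hk

end RelativeInterior

/-! ### Relatively open path polytopes -/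

section OpenPath

/-- The height as a linear functional. -/
def heightLin {β : Type*} (L : List (Step β)) : (β → ℝ) →ₗ[ℝ] ℝ where
  toFun x := height x L
  map_add' x y := by simpa using height_add_smul x y 1 1 L
  map_smul' a x := by simpa using height_add_smul x 0 a 0 L

/-- The inequalities that describe the bounds of the steps of `L`. -/
def constraints {β : Type*} : List (Step β) → Set (((β → ℝ) →ₗ[ℝ] ℝ) × ℝ)
  | [] => ∅
  | p :: L => {(-heightLin L, -(p.lo : ℝ)), (heightLin L, (p.hi : ℝ)),
      (-LinearMap.proj p.elt, -(p.bot : ℝ)), (LinearMap.proj p.elt, (p.top : ℝ))} ∪ constraints L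

variable {β : Type*}

theorem finite_constraints (L : List (Step β)) : (constraints L).Finite := by
  induction L with
  | nil => exact Set.finite_empty
  | cons p L ih => exact (Set.toFinite _).union ih

theorem mem_polyhedron_constraints {L : List (Step β)} {x : β → ℝ} :
    x ∈ polyhedron (constraints L) ↔ Holds Step.Closed x L := by
  induction L with
  | nil => simp [polyhedron, constraints, Holds]
  | cons p L ih =>
    rw [Holds, ← ih]
    simp [polyhedron, constraints, or_imp, forall_and, Step.Closed, heightLin, and_assoc]

/-- Tightness of an interval constraint, compared with a point `y₀` in its relative interior. -/
theorem mem_relIoo_iff {a b : ℤ} {y y₀ : ℝ} (hy : (a : ℝ) ≤ y ∧ y ≤ b) (hy₀ : y₀ ∈ relIoo a b) :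
    y ∈ relIoo a b ↔ (y = a → y₀ = a) ∧ (y = b → y₀ = b) := by
  rcases hy₀ with ⟨rfl, rfl⟩ | ⟨h1, h2⟩
  · have : y = a := le_antisymm hy.2 hy.1
    simp [relIoo, this]
  · have hab : a ≠ b := by
      rintro rfl
      linarith
    simp only [relIoo, Set.mem_ofPred_eq, hab, false_and, false_or]
    constructor
    · rintro ⟨h3, h4⟩
      exact ⟨fun h => absurd h h3.ne', fun h => absurd h h4.ne⟩
    · rintro ⟨h3, h4⟩
      exact ⟨lt_of_le_of_ne hy.1 fun h => h1.ne' (h3 h.symm),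
        lt_of_le_of_ne hy.2 fun h => h2.ne (h4 h)⟩

theorem eq_of_relIoo_tight {a b : ℤ} {y y₀ : ℝ} (hy : (a : ℝ) ≤ y ∧ y ≤ b)
    (hy₀ : y₀ ∈ relIoo a b) : (y₀ = a → y = a) ∧ (y₀ = b → y = b) := by
  rcases hy₀ with ⟨rfl, rfl⟩ | ⟨h1, h2⟩
  · have : y = a := le_antisymm hy.2 hy.1
    simp [this]
  · exact ⟨fun h => absurd h h1.ne', fun h => absurd h h2.ne⟩

/-- Given one point `x₀` of the open polytope, the open condition says that no more inequalities are
tight than at `x₀`. -/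
theorem holds_open_iff {L : List (Step β)} {x x₀ : β → ℝ} (hx : Holds Step.Closed x L)
    (hx₀ : Holds Step.Open x₀ L) :
    Holds Step.Open x L ↔ ∀ k ∈ constraints L, k.1 x = k.2 → k.1 x₀ = k.2 := by
  induction L with
  | nil => simp [constraints, Holds]
  | cons p L ih =>
    obtain ⟨⟨h1, h2⟩, h3⟩ := hx
    obtain ⟨⟨k1, k2⟩, k3⟩ := hx₀
    rw [Holds, ih h3 k3, Step.Open, mem_relIoo_iff h1 k1, mem_relIoo_iff h2 k2]
    simp [constraints, or_imp, forall_and, heightLin, and_assoc]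

theorem Holds.tight_of_open {L : List (Step β)} {x x₀ : β → ℝ} (hx : Holds Step.Closed x L)
    (hx₀ : Holds Step.Open x₀ L) : ∀ k ∈ constraints L, k.1 x₀ = k.2 → k.1 x = k.2 := by
  induction L with
  | nil => simp [constraints]
  | cons p L ih =>
    obtain ⟨⟨h1, h2⟩, h3⟩ := hx
    obtain ⟨⟨k1, k2⟩, k3⟩ := hx₀
    have e1 := eq_of_relIoo_tight h1 k1
    have e2 := eq_of_relIoo_tight h2 k2
    have e3 := ih h3 k3
    simpa [constraints, or_imp, forall_and, heightLin, e1, e2] using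
      ⟨⟨e1.1, e1.2, e2.1, e2.2⟩, fun a b h => e3 (a, b) h⟩

theorem Holds.closed_of_open {L : List (Step β)} {x : β → ℝ} (hx : Holds Step.Open x L) :
    Holds Step.Closed x L := by
  have key : ∀ {a b : ℤ} {y : ℝ}, y ∈ relIoo a b → (a : ℝ) ≤ y ∧ y ≤ b := by
    rintro a b y (⟨rfl, rfl⟩ | ⟨h1, h2⟩)
    · exact ⟨le_rfl, le_rfl⟩
    · exact ⟨h1.le, h2.le⟩
  induction L with
  | nil => trivial
  | cons p L ih => exact ⟨⟨key hx.1.1, key hx.1.2⟩, ih hx.2⟩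

/-- A nonempty relatively open path polytope is the relative interior of the closed one. -/
theorem intrinsicInterior_pathPolytope [Finite β] {L : List (Step β)} {r : ℤ} {x₀ : β → ℝ}
    (hx₀ : Holds Step.Open x₀ L) (hr : height x₀ L = r) :
    intrinsicInterior ℝ (pathPolytope L r) = {x | Holds Step.Open x L} ∩ {x | height x L = r} := by
  let S : Set (((β → ℝ) →ₗ[ℝ] ℝ) × ℝ) :=
    {(-heightLin L, -(r : ℝ)), (heightLin L, (r : ℝ))} ∪ constraints L
  have hS : S.Finite := (Set.toFinite _).union (finite_constraints L)
  have hP : pathPolytope L r = polyhedron S := by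
    ext x
    show Holds Step.Closed x L ∧ height x L = r ↔ _
    rw [← mem_polyhedron_constraints]
    simp only [polyhedron, S, Set.mem_union, or_imp, forall_and, Set.mem_insert_iff,
      Set.mem_singleton_iff, forall_eq, Set.mem_ofPred_eq, LinearMap.neg_apply, neg_le_neg_iff]
    rw [and_comm, le_antisymm_iff, and_comm (a := height x L ≤ r)]
    rfl
  have hmem : ∀ x ∈ pathPolytope L r, (x ∈ intrinsicInterior ℝ (pathPolytope L r) ↔
      Holds Step.Open x L) := by
    rintro x hx
    rw [hP, mem_intrinsicInterior_polyhedron hS (hP ▸ hx), ← hP, holds_open_iff hx.1 hx₀]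
    constructor
    · intro h k hk hkx
      exact h k (Or.inr hk) hkx x₀ ⟨hx₀.closed_of_open, hr⟩
    · rintro h k (hk | hk) hkx z hz
      · have hz' : height z L = r := hz.2
        rcases hk with rfl | hk
        · simp [heightLin, hz']
        · rw [Set.mem_singleton_iff.1 hk]; exact hz'
      · exact hz.1.tight_of_open hx₀ k hk (h k hk hkx)
  ext x
  constructor
  · intro h
    have hx := intrinsicInterior_subset h
    exact ⟨(hmem x hx).1 h, hx.2⟩
  · rintro ⟨h1, h2⟩
    have h1' : Holds Step.Open x L := h1
    exact (hmem x ⟨h1'.closed_of_open, h2⟩).2 h1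

end OpenPath

/-! ### Faces of base polytopes -/

section Faces

open Set Matroid

variable {α : Type*} {E : Set α}

/-- Symmetric basis exchange. The new element is found in the intersection of the fundamental
circuit of `e` in `B₂` with the fundamental cocircuit of `e` in `B₁`, which cannot be `{e}`. -/
theorem exists_symmetric_exchange {M : Matroid α} {B₁ B₂ : Set α} (h₁ : M.IsBase B₁)
    (h₂ : M.IsBase B₂) {e : α} (he : e ∈ B₁ \ B₂) :
    ∃ f ∈ B₂ \ B₁, M.IsBase (insert f (B₁ \ {e})) ∧ M.IsBase (insert e (B₂ \ {f})) := by
  have heE := h₁.subset_ground he.1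
  obtain ⟨f, ⟨hfC, hfK⟩, hfe⟩ := ((h₂.fundCircuit_isCircuit heE he.2).isCocircuit_inter_nontrivial
    (fundCocircuit_isCocircuit he.1 h₁)
    ⟨e, M.mem_fundCircuit e B₂, M.mem_fundCocircuit e B₁⟩).exists_ne e
  have hf₂ : f ∈ B₂ := (M.fundCircuit_subset_insert e B₂ hfC).resolve_left hfe
  have hf₁ : f ∈ M.E \ B₁ := (M.fundCocircuit_subset_insert_compl e B₁ hfK).resolve_left hfe
  refine ⟨f, ⟨hf₂, hf₁.2⟩, h₁.exchange_isBase_of_indep hf₁.2 ?_,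
    h₂.exchange_isBase_of_indep he.2 ?_⟩
  · rw [h₁.mem_fundCocircuit_iff_mem_fundCircuit, h₁.indep.mem_fundCircuit_iff
      (by rw [h₁.closure_eq]; exact hf₁.1) hf₁.2] at hfK
    rwa [insert_sdiff_singleton_comm hfe]
  · rw [h₂.indep.mem_fundCircuit_iff (by rw [h₂.closure_eq]; exact heE) he.2] at hfC
    rwa [insert_sdiff_singleton_comm hfe.symm]

theorem basePolytope_eq_convexHull_charPt (M : MatroidOn E) :
    basePolytope M = convexHull ℝ {x | ∃ B, M.1.IsBase B ∧ x = charPt E B} := rfl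

theorem charPt_mem_basePolytope (M : MatroidOn E) {B : Set α} (hB : M.1.IsBase B) :
    charPt E B ∈ basePolytope M :=
  subset_convexHull ℝ _ ⟨B, hB, rfl⟩

theorem finite_setOf_isBase [Finite E] (M : MatroidOn E) : {B | M.1.IsBase B}.Finite :=
  (toFinite E).finite_subsets.subset fun _ hB => hB.subset_ground.trans M.2.subset

theorem finite_setOf_charPt [Finite E] (M : MatroidOn E) :
    {x | ∃ B, M.1.IsBase B ∧ x = charPt E B}.Finite :=
  ((finite_setOf_isBase M).image (charPt E)).subset <| by
    rintro _ ⟨B, hB, rfl⟩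
    exact mem_image_of_mem _ hB

theorem charPt_exchange {B₁ B₂ : Set α} {e f : α} (he : e ∈ B₁ \ B₂) (hf : f ∈ B₂ \ B₁) :
    charPt E (insert f (B₁ \ {e})) + charPt E (insert e (B₂ \ {f})) =
      charPt E B₁ + charPt E B₂ := by
  classical
  have hef : e ≠ f := fun h => he.2 (h ▸ hf.1)
  funext i
  simp only [Pi.add_apply, charPt, indicator_apply, mem_insert_iff, mem_sdiff, mem_singleton_iff]
  by_cases h1 : (i : α) = e
  · have h2 : (i : α) ≠ f := h1 ▸ hef
    simp [h1, he.1, he.2, hef]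
  · by_cases h2 : (i : α) = f
    · simp [h2, hf.1, hf.2, hef.symm]
    · simp [h1, h2]

/-- Every nonempty face of a base polytope is a base polytope: symmetric exchange stays within the
bases on which a linear functional is maximal. -/
theorem exists_basePolytope_eq_face [Finite E] (M : MatroidOn E) (w : (E → ℝ) →ₗ[ℝ] ℝ) (c : ℝ)
    (hw : ∀ x ∈ basePolytope M, w x ≤ c) (hne : (basePolytope M ∩ {x | w x = c}).Nonempty) :
    ∃ N : MatroidOn E, basePolytope N = basePolytope M ∩ {x | w x = c} ∧
      ∀ B, N.1.IsBase B ↔ M.1.IsBase B ∧ w (charPt E B) = c := by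
  have hcont : Continuous w := w.continuous_of_finiteDimensional
  let V : Set (E → ℝ) := {x | ∃ B, M.1.IsBase B ∧ x = charPt E B}
  let F : Set (E → ℝ) := basePolytope M ∩ {x | w x = c}
  have hV : V.Finite := finite_setOf_charPt M
  have hconv : Convex ℝ F :=
    (convex_convexHull ℝ V).inter (convex_hyperplane w.isLinear c)
  have hcomp : IsCompact F :=
    hV.isCompact_convexHull ℝ |>.inter_right (isClosed_singleton.preimage hcont)
  have hexp : IsExposed ℝ (basePolytope M) F := by
    rintro ⟨x₀, hx₀, hx₀c⟩
    refine ⟨⟨w, hcont⟩, ?_⟩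
    ext x
    constructor
    · rintro ⟨h1, h2⟩
      exact ⟨h1, fun y hy => (hw y hy).trans_eq h2.symm⟩
    · rintro ⟨h1, h2⟩
      exact ⟨h1, le_antisymm (hw x h1) (hx₀c.symm.trans_le (h2 x₀ hx₀))⟩
  have hF : F = convexHull ℝ (V ∩ F) := by
    refine Subset.antisymm ?_ (convexHull_min inter_subset_right hconv)
    rw [← ((hV.subset inter_subset_left).isClosed_convexHull ℝ).closure_eq]
    refine (closure_convexHull_extremePoints hcomp hconv).symm.subset.trans
      (closure_mono (convexHull_mono fun x hx => ⟨?_, hx.1⟩))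
    exact extremePoints_convexHull_subset (hexp.isExtreme.extremePoints_subset_extremePoints hx)
  obtain ⟨B₀, hB₀, hB₀c⟩ : ∃ B, M.1.IsBase B ∧ w (charPt E B) = c := by
    have : F.Nonempty := hne
    rw [hF, convexHull_nonempty_iff] at this
    obtain ⟨_, ⟨B, hB, rfl⟩, h⟩ := this
    exact ⟨B, hB, h.2⟩
  have hexch : ExchangeProperty fun B => M.1.IsBase B ∧ w (charPt E B) = c := by
    rintro B₁ B₂ ⟨h₁, hc₁⟩ ⟨h₂, hc₂⟩ e he
    obtain ⟨f, hf, h₁', h₂'⟩ := exists_symmetric_exchange h₁ h₂ he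
    refine ⟨f, hf, h₁', ?_⟩
    have h3 := congrArg w (charPt_exchange (E := E) he hf)
    rw [map_add, map_add, hc₁, hc₂] at h3
    have h4 := hw _ (charPt_mem_basePolytope M h₁')
    have h5 := hw _ (charPt_mem_basePolytope M h₂')
    linarith
  let N : MatroidOn E := ⟨Matroid.ofIsBaseOfFinite (toFinite E) _ ⟨B₀, hB₀, hB₀c⟩ hexch
    fun B hB => hB.1.subset_ground.trans M.2.subset, rfl⟩
  refine ⟨N, ?_, fun B => Iff.rfl⟩
  change _ = F
  rw [hF, basePolytope_eq_convexHull_charPt]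
  congr 1
  ext x
  constructor
  · rintro ⟨B, ⟨hB, hc⟩, rfl⟩
    exact ⟨⟨B, hB, rfl⟩, charPt_mem_basePolytope M hB, hc⟩
  · rintro ⟨⟨B, hB, rfl⟩, -, hc⟩
    exact ⟨B, ⟨hB, hc⟩, rfl⟩

theorem exists_basePolytope_eq_polyhedron [Finite E] (M : MatroidOn E) :
    ∃ S : Finset (((E → ℝ) →ₗ[ℝ] ℝ) × ℝ), basePolytope M = polyhedron (S : Set _) := by
  classical
  have := Fintype.ofFinite E
  let s : Finset E → (E → ℝ) →ₗ[ℝ] ℝ := fun X => ∑ i ∈ X, LinearMap.proj i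
  have hs : ∀ X x, s X x = ∑ i ∈ X, x i := fun X x => by simp [s, LinearMap.sum_apply]
  let T : Set (((E → ℝ) →ₗ[ℝ] ℝ) × ℝ) :=
    (range (fun i : E => (-LinearMap.proj i, (0 : ℝ))) ∪
      range (fun i : E => (LinearMap.proj i, (1 : ℝ)))) ∪
    (range (fun X => (s X, (rankFn M X : ℝ))) ∪
      {(-s Finset.univ, -(rankFn M Finset.univ : ℝ))})
  have hT : T.Finite := toFinite T
  refine ⟨hT.toFinset, ?_⟩
  rw [basePolytope_eq_rankPolytope, Finite.coe_toFinset]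
  ext x
  simp only [polyhedron, T, mem_union, or_imp, forall_and, mem_range, mem_singleton_iff,
    forall_exists_index, forall_apply_eq_imp_iff, forall_eq, mem_ofPred_eq, LinearMap.neg_apply,
    neg_le_neg_iff, hs, LinearMap.proj_apply, neg_nonpos, rankPolytope, mem_inter_iff]
  constructor
  · rintro ⟨⟨⟨h0, h1⟩, h2⟩, h3⟩
    exact ⟨⟨h0, h1⟩, h3, h2.ge⟩
  · rintro ⟨⟨h0, h1⟩, h2, h3⟩
    exact ⟨⟨⟨h0, h1⟩, le_antisymm (h2 _) h3⟩, h2⟩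

/-- The boundary of a base polytope decomposes into the relative interiors of base polytopes of
matroids with fewer bases. -/
theorem polytopeIndicator_sub_interiorIndicator_mem [Finite E] (M : MatroidOn E)
    (G : AddSubgroup ((E → ℝ) → ℤ))
    (hG : ∀ N : MatroidOn E, {B | N.1.IsBase B}.ncard < {B | M.1.IsBase B}.ncard →
      interiorIndicator N ∈ G) :
    polytopeIndicator M - interiorIndicator M ∈ G := by
  obtain ⟨S, hS⟩ := exists_basePolytope_eq_polyhedron M
  rw [polytopeIndicator_eq_indZ, interiorIndicator_eq_indZ, hS]
  refine indZ_sub_interior_mem S G fun J hJ hne hproper => ?_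
  rw [← hS] at hne hproper ⊢
  have hle : ∀ x ∈ basePolytope M, ∀ k ∈ J, k.1 x ≤ k.2 := fun x hx k hk =>
    (hS ▸ hx : x ∈ polyhedron (S : Set _)) k (hJ hk)
  -- the face is where the sum of the inequalities in `J` is tight
  have hface : basePolytope M ∩ {x | ∀ k ∈ J, k.1 x = k.2} =
      basePolytope M ∩ {x | (∑ k ∈ J, k.1) x = ∑ k ∈ J, k.2} := by
    ext x
    refine and_congr_right fun hx => ?_
    rw [mem_ofPred_eq, mem_ofPred_eq, LinearMap.sum_apply, Finset.sum_eq_sum_iff_of_le (hle x hx)]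
  rw [hface] at hne hproper ⊢
  obtain ⟨N, hN, hbase⟩ := exists_basePolytope_eq_face M _ _ (fun x hx => by
    rw [LinearMap.sum_apply]; exact Finset.sum_le_sum (hle x hx)) hne
  rw [← hN, ← interiorIndicator_eq_indZ]
  refine hG N (ncard_lt_ncard (ssubset_of_subset_of_ne (fun B hB => ((hbase B).1 hB).1) ?_)
    (finite_setOf_isBase M))
  intro heq
  refine hproper ?_
  have hiff : ∀ B, N.1.IsBase B ↔ M.1.IsBase B := fun B => Set.ext_iff.1 heq B
  rw [← hN, basePolytope_eq_convexHull_charPt, basePolytope_eq_convexHull_charPt]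
  simp only [hiff]

end Faces

/-! ### Spanning by series-parallel matroids -/

section Spanning

open Set Matroid

variable {α : Type*} {E : Set α}

theorem polytopeIndicator_mem_closure [Finite E] (M : MatroidOn E) :
    polytopeIndicator M ∈ AddSubgroup.closure
      {u | ∃ N : MatroidOn E, IsSeriesParallelLoopSum N.1 ∧ u = polytopeIndicator N} := by
  refine polytopeIndicator_mem M _ fun L r hL hmem hn => ?_
  rcases eq_empty_or_nonempty (pathPolytope L r) with he | hne
  · rw [he, indZ_empty]; exact zero_mem _
  · obtain ⟨N, hN, hNP⟩ := exists_basePolytope_eq_pathPolytope hL hmem hn hne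
    exact AddSubgroup.subset_closure ⟨N, hN, by rw [polytopeIndicator_eq_indZ, hNP]⟩

/-- The open analogue of `polytopeIndicator_mem_closure`, by induction on the number of bases. -/
theorem interiorIndicator_mem_closure [Finite E] (M : MatroidOn E) :
    interiorIndicator M ∈ AddSubgroup.closure
      {u | ∃ N : MatroidOn E, IsSeriesParallelLoopSum N.1 ∧ u = interiorIndicator N} := by
  induction hn : {B | M.1.IsBase B}.ncard using Nat.strong_induction_on generalizing M with
  | _ n ih =>
  have h1 : polytopeIndicator M ∈ AddSubgroup.closure
      {u | ∃ N : MatroidOn E, IsSeriesParallelLoopSum N.1 ∧ u = interiorIndicator N} := by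
    refine polytopeIndicator_mem M _ fun L r hL hmem hnar =>
      indZ_pathPolytope_mem_open L r hnar _ fun L' hL' hnar' => ?_
    rw [← hL'] at hL hmem
    rcases eq_empty_or_nonempty ({x : E → ℝ | Holds Step.Open x L'} ∩ {x | height x L' = r}) with
      he | ⟨x₀, hx₀, hr⟩
    · rw [he, indZ_empty]; exact zero_mem _
    · have hx₀' : Holds Step.Open x₀ L' := hx₀
      obtain ⟨N, hN, hNP⟩ := exists_basePolytope_eq_pathPolytope hL hmem hnar'
        ⟨x₀, hx₀'.closed_of_open, hr⟩
      refine AddSubgroup.subset_closure ⟨N, hN, ?_⟩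
      rw [interiorIndicator_eq_indZ, hNP, intrinsicInterior_pathPolytope hx₀' hr]
  have h2 := polytopeIndicator_sub_interiorIndicator_mem M _ fun N hN => ih _ (hn ▸ hN) N rfl
  have h3 := sub_mem h1 h2
  rwa [sub_sub_cancel] at h3

end Spanning

/-! ### Uniqueness -/

section Uniqueness

open Matroid

theorem hom_eq_of_mem_closure {G A : Type*} [AddCommGroup G] [AddCommGroup A]
    {H : AddSubgroup G} (F₁ F₂ : H →+ A) {T : Set G}
    (hT : ∀ u (hu : u ∈ H), u ∈ T → F₁ ⟨u, hu⟩ = F₂ ⟨u, hu⟩) (hTH : T ⊆ H) {a : G}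
    (ha : a ∈ AddSubgroup.closure T) (haH : a ∈ H) : F₁ ⟨a, haH⟩ = F₂ ⟨a, haH⟩ := by
  have h : AddSubgroup.closure T ≤ (F₁.eqLocus F₂).map H.subtype :=
    (AddSubgroup.closure_le _).2 fun u hu => ⟨⟨u, hTH hu⟩, hT u _ hu, rfl⟩
  obtain ⟨b, hb, rfl⟩ := h ha
  exact hb

variable {α : Type*} {E : Set α} {A : Type*} [AddCommGroup A]

theorem IsValuation.eq_of_agree [Finite E] {f₁ f₂ : MatroidOn E → A} (h₁ : IsValuation f₁)
    (h₂ : IsValuation f₂)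
    (h : ∀ N : MatroidOn E, IsSeriesParallelLoopSum N.1 → f₁ N = f₂ N) : f₁ = f₂ := by
  obtain ⟨F₁, hF₁⟩ := h₁
  obtain ⟨F₂, hF₂⟩ := h₂
  funext M
  rw [hF₁, hF₂]
  refine hom_eq_of_mem_closure F₁ F₂ ?_ ?_ (polytopeIndicator_mem_closure M) _
  · rintro _ hu ⟨N, hN, rfl⟩
    rw [← hF₁, ← hF₂, h N hN]
  · rintro _ ⟨N, -, rfl⟩
    exact AddSubgroup.subset_closure (Set.mem_range_self N)

theorem IsCovaluation.eq_of_agree [Finite E] {f₁ f₂ : MatroidOn E → A} (h₁ : IsCovaluation f₁)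
    (h₂ : IsCovaluation f₂)
    (h : ∀ N : MatroidOn E, IsSeriesParallelLoopSum N.1 → f₁ N = f₂ N) : f₁ = f₂ := by
  obtain ⟨F₁, hF₁⟩ := h₁
  obtain ⟨F₂, hF₂⟩ := h₂
  funext M
  rw [hF₁, hF₂]
  refine hom_eq_of_mem_closure F₁ F₂ ?_ ?_ (interiorIndicator_mem_closure M) _
  · rintro _ hu ⟨N, hN, rfl⟩
    rw [← hF₁, ← hF₂, h N hN]
  · rintro _ ⟨N, -, rfl⟩
    exact AddSubgroup.subset_closure (Set.mem_range_self N)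

/-- A direct sum of series-parallel matroids and loops has a loop unless there are no loop
summands, and series-parallel matroids are connected. -/
theorem IsSeriesParallelLoopSum.exists_isLoop_or {M : Matroid α} (h : IsSeriesParallelLoopSum M) :
    (∃ e, M.IsLoop e) ∨
      ∃ m, IsDirectSumOf (fun N => IsConnected N ∧ IsSeriesParallel N) m M := by
  obtain ⟨m, N, hd, hN, rfl⟩ := h
  by_cases hl : ∃ i e, N i = loopyOn {e}
  · obtain ⟨i, e, hi⟩ := hl
    refine Or.inl ⟨e, ?_⟩
    have heE : e ∈ (N i).E := by rw [hi]; rfl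
    rw [← singleton_dep, dep_iff, disjointSigma_indep_iff, disjointSigma_ground_eq]
    refine ⟨fun h' => ?_, Set.singleton_subset_iff.2 (Set.mem_iUnion.2 ⟨i, heE⟩)⟩
    have h1 := h'.1 i
    rw [Set.inter_eq_self_of_subset_left (Set.singleton_subset_iff.2 heE), hi,
      loopyOn_indep_iff] at h1
    exact Set.singleton_ne_empty e h1
  · push Not at hl
    refine Or.inr ⟨m, N, hd, fun i => ?_, rfl⟩
    have hi : IsSeriesParallel (N i) := (hN i).resolve_right fun ⟨e, he⟩ => hl i e he
    exact ⟨hi.isConnected, hi⟩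

theorem IsSpeyerInvariant.unique {g₁ g₂ : FinMatroid → Polynomial ℤ} (h₁ : IsSpeyerInvariant g₁)
    (h₂ : IsSpeyerInvariant g₂) : g₁ = g₂ := by
  funext M
  have : Finite M.1.E := M.2
  refine congrFun ((h₁.covaluative _ M.2).eq_of_agree (h₂.covaluative _ M.2) fun N hN => ?_)
    ⟨M.1, rfl⟩
  rcases hN.exists_isLoop_or with hl | ⟨m, hm⟩
  · exact (h₁.loops _ hl).trans (h₂.loops _ hl).symm
  · exact (h₁.seriesParallel _ m hm).trans (h₂.seriesParallel _ m hm).symm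

end Uniqueness

end MatroidSpan

theorem theorem4p12 {α : Type*} (E : Set α) (hE : E.Finite) (A : Type*) [AddCommGroup A] :
    (∀ M : MatroidSpan.MatroidOn E,
      MatroidSpan.polytopeIndicator M ∈ AddSubgroup.closure
        {u | ∃ N : MatroidSpan.MatroidOn E,
          MatroidSpan.IsSeriesParallelLoopSum N.1 ∧ u = MatroidSpan.polytopeIndicator N}) ∧
    (∀ f₁ f₂ : MatroidSpan.MatroidOn E → A,
      MatroidSpan.IsValuation f₁ → MatroidSpan.IsValuation f₂ →
      (∀ N : MatroidSpan.MatroidOn E, MatroidSpan.IsSeriesParallelLoopSum N.1 → f₁ N = f₂ N) →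
      f₁ = f₂) ∧
    (∀ g₁ g₂ : MatroidSpan.FinMatroid → Polynomial ℤ,
      MatroidSpan.IsSpeyerInvariant g₁ → MatroidSpan.IsSpeyerInvariant g₂ → g₁ = g₂) := by
  have : Finite E := hE
  exact ⟨MatroidSpan.polytopeIndicator_mem_closure,
    fun _ _ h₁ h₂ h => h₁.eq_of_agree h₂ h, fun _ _ h₁ h₂ => h₁.unique h₂⟩
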